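/- Let $U\subseteq\mathbb R^n$ be bounded and open. For $f:X\to\mathbb R^m$ let $\operatorname{Lip}(f,X)=\sup_{x,y\in X,\,x\ne y}|f(x)-f(y)|/|x-y|$, and for $f:\overline U\to\mathbb R^m$ Lipschitz and $x\in U$ let $\mathrm Lf(x)=\inf_{r>0}\operatorname{Lip}(f,U\cap B_r(x))$. For Lipschitz $u,v:\overline U\to\mathbb R^m$, say that $v$ is tighter than $u$ if $u=v$ on $\partial U$ and $$\sup\{\mathrm Lu(x): x\in U,\ \mathrm Lv(x)<\mathrm Lu(x)\}>\sup\{\mathrm Lv(x): x\in U,\ \mathrm Lv(x)>\mathrm Lu(x)\},$$ where $\sup\emptyset=0$; $u$ is tight if no $v$ is tighter than $u$. Let $u:\overline U\to\mathbb R^m$ be Lipschitz with $u\in C^3(U,\mathbb R^m)$, and let $a\in C^2(U,\mathbb R^n)$ be a principal direction field for $u$, that is, for every $x\in U$, $|a(x)|=1$ and $a(x)$ spans the eigenspace of the largest eigenvalue of $Du(x)^tDu(x)$ (so that this eigenvalue is simple). Write $w_a:=\sum_i w_{x_i}a^i$ for the derivative of $w$ along $a$. Then $u$ is tight if and only if $$-(u_a)_a=0\quad\text{in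 }U.$$ Moreover, this equation holds if and only if $u$ maps each principal flow curve onto a part of a straight line at constant speed: for every maximal solution $\gamma:I\to U$ of $\gamma'=a(\gamma)$ on an open interval $I$ there are $p,q\in\mathbb R^m$ with $u(\gamma(t))=p+tq$ for all $t\in I$, where $q\neq0$ if $n\ge2$. -/

import Mathlib

open scoped ENNReal NNReal

/-- `Lip(f, X) = sup_{x, y ∈ X} |f(x) - f(y)| / |x - y|`, with values in `[0, ∞]`
(the diagonal contributes `0 / 0 = 0`). -/
noncomputable def Lip {n m : ℕ}
    (f : EuclideanSpace ℝ (Fin n) → EuclideanSpace ℝ (Fin m))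
    (X : Set (EuclideanSpace ℝ (Fin n))) : ℝ≥0∞ :=
  ⨆ x ∈ X, ⨆ y ∈ X, edist (f x) (f y) / edist x y

/-- The local Lipschitz constant `L u(x) = inf_{r > 0} Lip(u, U ∩ B_r(x))`. -/
noncomputable def localLip {n m : ℕ} (U : Set (EuclideanSpace ℝ (Fin n)))
    (u : EuclideanSpace ℝ (Fin n) → EuclideanSpace ℝ (Fin m))
    (x : EuclideanSpace ℝ (Fin n)) : ℝ≥0∞ :=
  ⨅ (r : ℝ) (_ : 0 < r), Lip u (U ∩ Metric.ball x r)

/-- `u` is Lipschitz on the closure of `U` (in particular continuous there). -/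
def IsLipschitzOnClosure {n m : ℕ} (U : Set (EuclideanSpace ℝ (Fin n)))
    (u : EuclideanSpace ℝ (Fin n) → EuclideanSpace ℝ (Fin m)) : Prop :=
  ∃ K : ℝ≥0, LipschitzOnWith K u (closure U)

/-- `v` is tighter than `u` on `U`: both are Lipschitz on the closure of `U`, they agree on `∂U`, and
`sup {L u : L v < L u} > sup {L v : L v > L u}`, the suprema being over points of `U`
(the supremum of the empty set is `0`). -/
def IsTighter {n m : ℕ} (U : Set (EuclideanSpace ℝ (Fin n)))
    (v u : EuclideanSpace ℝ (Fin n) → EuclideanSpace ℝ (Fin m)) : Prop :=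
  IsLipschitzOnClosure U u ∧ IsLipschitzOnClosure U v ∧ Set.EqOn u v (frontier U) ∧
    (⨆ x ∈ {x ∈ U | localLip U v x < localLip U u x}, localLip U u x) >
      (⨆ x ∈ {x ∈ U | localLip U v x > localLip U u x}, localLip U v x)

/-- `u` is tight on `U`: it is Lipschitz on the closure and there is no tighter function. -/
def IsTight {n m : ℕ} (U : Set (EuclideanSpace ℝ (Fin n)))
    (u : EuclideanSpace ℝ (Fin n) → EuclideanSpace ℝ (Fin m)) : Prop :=
  IsLipschitzOnClosure U u ∧
    ¬ ∃ v : EuclideanSpace ℝ (Fin n) → EuclideanSpace ℝ (Fin m), IsTighter U v u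

/-- The endomorphism `Du(x)ᵗ Du(x)` of `ℝⁿ`. -/
noncomputable def gramDeriv {n m : ℕ}
    (u : EuclideanSpace ℝ (Fin n) → EuclideanSpace ℝ (Fin m))
    (x : EuclideanSpace ℝ (Fin n)) : Module.End ℝ (EuclideanSpace ℝ (Fin n)) :=
  ((ContinuousLinearMap.adjoint (fderiv ℝ u x)).comp (fderiv ℝ u x)).toLinearMap

/-- `a` is a principal direction field for `u` on `U`: a continuous unit vector field such that
`a x` spans the eigenspace of the largest eigenvalue of `Du(x)ᵗ Du(x)` for each `x ∈ U`. -/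
structure IsPrincipalDirectionField {n m : ℕ} (U : Set (EuclideanSpace ℝ (Fin n)))
    (u : EuclideanSpace ℝ (Fin n) → EuclideanSpace ℝ (Fin m))
    (a : EuclideanSpace ℝ (Fin n) → EuclideanSpace ℝ (Fin n)) : Prop where
  continuousOn : ContinuousOn a U
  norm_eq_one : ∀ x ∈ U, ‖a x‖ = 1
  eigenspace_eq_span : ∀ x ∈ U, ∃ lam : ℝ,
    IsGreatest {μ : ℝ | Module.End.HasEigenvalue (gramDeriv u x) μ} lam ∧
      Module.End.eigenspace (gramDeriv u x) lam = Submodule.span ℝ {a x}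

/-- The derivative `v_a = v_{x_i} aⁱ` of `v` along the vector field `a`. -/
noncomputable def derivAlong {n k : ℕ}
    (a : EuclideanSpace ℝ (Fin n) → EuclideanSpace ℝ (Fin n))
    (v : EuclideanSpace ℝ (Fin n) → EuclideanSpace ℝ (Fin k)) :
    EuclideanSpace ℝ (Fin n) → EuclideanSpace ℝ (Fin k) :=
  fun x => fderiv ℝ v x (a x)

/-- `γ` is, on the nonempty open interval `I`, a curve in `U` with `γ' = a(γ)`. When `a` is a unit
field these are the arc-length parametrizations of the curves in `U` parallel to `a`, oriented
by `a`. -/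
structure IsFlowArc {n : ℕ} (U : Set (EuclideanSpace ℝ (Fin n)))
    (a : EuclideanSpace ℝ (Fin n) → EuclideanSpace ℝ (Fin n))
    (I : Set ℝ) (γ : ℝ → EuclideanSpace ℝ (Fin n)) : Prop where
  isOpen : IsOpen I
  ordConnected : I.OrdConnected
  nonempty : I.Nonempty
  mem : ∀ t ∈ I, γ t ∈ U
  isIntegralCurveOn : IsIntegralCurveOn γ (fun _ => a) I

/-- A flow curve of `a` in `U`: a flow arc that cannot be extended to a larger interval. For a
principal direction field `a` these are the principal flow curves. -/
def IsFlowCurve {n : ℕ} (U : Set (EuclideanSpace ℝ (Fin n)))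
    (a : EuclideanSpace ℝ (Fin n) → EuclideanSpace ℝ (Fin n))
    (I : Set ℝ) (γ : ℝ → EuclideanSpace ℝ (Fin n)) : Prop :=
  IsFlowArc U a I γ ∧
    ∀ (J : Set ℝ) (δ : ℝ → EuclideanSpace ℝ (Fin n)),
      IsFlowArc U a J δ → I ⊆ J → Set.EqOn δ γ I → J = I

/-- `u` maps the curve `γ` (parametrized by arc length on `I`) onto a part of a straight line at
constant speed: `u (γ t) = p + t q` on `I`. The speed `|q|` is required to be positive, except in
dimension `n = 1`, where a principal direction field exists even if `Du = 0`. -/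
def MapsToLineAtConstantSpeed {n m : ℕ}
    (u : EuclideanSpace ℝ (Fin n) → EuclideanSpace ℝ (Fin m))
    (I : Set ℝ) (γ : ℝ → EuclideanSpace ℝ (Fin n)) : Prop :=
  ∃ p q : EuclideanSpace ℝ (Fin m), (2 ≤ n → q ≠ 0) ∧ ∀ t ∈ I, u (γ t) = p + t • q

/-!
Write `w = u_a`. Since `a` is a top eigenvector of `Duᵗ Du`, the local Lipschitz constant of `u` at
a point of `U` is `|Du| = |w|` (`localLip_eq_enorm_fderiv`, `IsTopDirection.opNorm_eq`).

If `w_a = 0`, then `w` is constant along the flow curves of `a`, so that `u` is affine on each of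
them, with speed `|w|` (`IsFlowArc.exists_eq_line`). Suppose that `v` is tighter than `u`. There is a
point `x` with `L v(x) < L u(x)` at which `L u(x)` exceeds every value of `L v` taken where
`L v > L u`. On the flow curve through `x` the value of `L u` is constant, hence `L v ≤ L u` on all
of it, with strict inequality near `x`. If `L u(x) > 0`, as it is here, the curve has finite length
because `u` is bounded, and both its ends lie on `∂U`, where `u = v`
(`IsFlowCurve.notMem_of_tendsto_right`). There `v` would have to cover the same distance as `u`, which
runs along a straight line at the full speed `L u`; this is impossible (`isTight_of_lines`).

If `w_a` does not vanish identically, a tighter function `u + ε φ` is built with a small `φ` of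
compact support. Because the top eigenvalue is simple,
`|D(u + ε φ)|² ≤ |Du|² + 2 ε w · φ_a + O(ε² |Dφ|²)` (`norm_add_sq_le_of_gap`), so it suffices that
`w · φ_a ≤ -C |Dφ|²` on some set `{|Du|² > c}` that contains a point where the left-hand side is
negative (`exists_isTighter_of_perturbation`). When `w · w_a ≠ 0` somewhere, `|w|` is strictly
monotone along the flow nearby and `φ = ± f w` works, with a cutoff `f` that decreases in the flow
direction of increasing `|w|` (`exists_isTighter_of_inner_ne_zero`). When `w · w_a = 0` everywhere,
differentiating along `a` gives `w · w_aa = -|w_a|²`, and `φ = f w_a` works with any cutoff `f` that is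
the square of a bump function (`exists_isTighter_of_inner_eq_zero`).

The equivalence of `w_a = 0` with the description by straight lines is the computation of two
derivatives along flow curves, once it is known that a maximal flow curve passes through every point
(`exists_isFlowCurve_of_mem`).
-/

/-! ### The local Lipschitz constant of a `C¹` map -/

lemma lip_le_coe_iff {n m : ℕ} {f : EuclideanSpace ℝ (Fin n) → EuclideanSpace ℝ (Fin m)}
    {X : Set (EuclideanSpace ℝ (Fin n))} {K : ℝ≥0} :
    Lip f X ≤ K ↔ LipschitzOnWith K f X := by
  simp only [Lip, iSup_le_iff]
  refine ⟨fun h x hx y hy => ?_, fun h x hx y hy => ENNReal.div_le_of_le_mul (h hx hy)⟩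
  rcases eq_or_ne x y with rfl | hne
  · simp
  · exact (ENNReal.div_le_iff (by simpa using hne) (edist_ne_top x y)).1 (h x hx y hy)

lemma exists_lipschitzOnWith_of_localLip_lt {n m : ℕ} {U : Set (EuclideanSpace ℝ (Fin n))}
    {v : EuclideanSpace ℝ (Fin n) → EuclideanSpace ℝ (Fin m)}
    {x : EuclideanSpace ℝ (Fin n)} {K : ℝ≥0} (h : localLip U v x < K) :
    ∃ r > 0, LipschitzOnWith K v (U ∩ Metric.ball x r) := by
  simp only [localLip, iInf_lt_iff] at h
  obtain ⟨r, hr, h⟩ := h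
  exact ⟨r, hr, lip_le_coe_iff.1 h.le⟩

/-- At a point near which `v` is `C¹`, the local Lipschitz constant is the operator norm of the
derivative. -/
lemma localLip_eq_enorm_fderiv {n m : ℕ} {U : Set (EuclideanSpace ℝ (Fin n))} (hU : IsOpen U)
    {v : EuclideanSpace ℝ (Fin n) → EuclideanSpace ℝ (Fin m)}
    {x : EuclideanSpace ℝ (Fin n)} (hx : x ∈ U) (hv : ContDiffAt ℝ 1 v x) :
    localLip U v x = ‖fderiv ℝ v x‖ₑ := by
  apply le_antisymm
  · refine ENNReal.le_of_forall_pos_le_add fun ε hε _ => ?_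
    have hlt : ‖fderiv ℝ v x‖₊ < ‖fderiv ℝ v x‖₊ + ε := lt_add_of_pos_right _ hε
    obtain ⟨s, hs, hlip⟩ :=
      (hv.hasStrictFDerivAt one_ne_zero).exists_lipschitzOnWith_of_nnnorm_lt _ hlt
    obtain ⟨r, hr, hrs⟩ := Metric.mem_nhds_iff.1 hs
    refine (iInf₂_le r hr).trans ?_
    have := lip_le_coe_iff.2 (hlip.mono (Set.inter_subset_right.trans hrs) :
      LipschitzOnWith _ v (U ∩ Metric.ball x r))
    simpa [enorm_eq_nnnorm] using this
  · refine ENNReal.le_of_forall_pos_le_add fun ε hε hfin => ?_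
    lift localLip U v x to ℝ≥0 using hfin.ne with L hL
    have hlt : localLip U v x < (L + ε : ℝ≥0) := by
      rw [← hL]; exact_mod_cast lt_add_of_pos_right _ hε
    obtain ⟨r, hr, hlip⟩ := exists_lipschitzOnWith_of_localLip_lt hlt
    have := norm_fderiv_le_of_lipschitzOn ℝ
      (Filter.inter_mem (hU.mem_nhds hx) (Metric.ball_mem_nhds x hr)) hlip
    rw [enorm_eq_nnnorm]
    exact_mod_cast this

/-! ### Perturbation of a simple top singular value -/

section Spectral

variable {E F : Type*} [NormedAddCommGroup E] [InnerProductSpace ℝ E]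
  [NormedAddCommGroup F] [InnerProductSpace ℝ F]

/-- Perturbation of a simple top singular value: to first order `‖T + S‖²` exceeds `‖T a‖²` by
`2 ⟨T a, S a⟩`, with an explicit quadratic error in terms of the spectral gap `δ`. -/
lemma norm_add_sq_le_of_gap {T S : E →L[ℝ] F} {a : E} {δ : ℝ} (hδ : 0 < δ) (ha : ‖a‖ = 1)
    (horth : ∀ b, inner ℝ (T a) (T b) = ‖T a‖ ^ 2 * inner ℝ a b)
    (hgap : ∀ b, δ * ‖b‖ ^ 2 ≤ ‖T a‖ ^ 2 * ‖b‖ ^ 2 - ‖T b‖ ^ 2 + inner ℝ a b ^ 2) :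
    ‖T + S‖ ^ 2 ≤ ‖T a‖ ^ 2 + 2 * inner ℝ (T a) (S a) + (1 + 16 * ‖T‖ ^ 2 / δ) * ‖S‖ ^ 2 := by
  have unit : ∀ x : E, ‖x‖ = 1 → ‖(T + S) x‖ ^ 2 ≤
      ‖T a‖ ^ 2 + 2 * inner ℝ (T a) (S a) + (1 + 16 * ‖T‖ ^ 2 / δ) * ‖S‖ ^ 2 := by
    intro x hx
    obtain ⟨α, b, rfl, hab⟩ : ∃ (α : ℝ) (b : E), x = α • a + b ∧ inner ℝ a b = 0 :=
      ⟨inner ℝ a x, x - inner ℝ a x • a, by simp,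
        by rw [inner_sub_right, real_inner_smul_right, real_inner_self_eq_norm_sq, ha]; ring⟩
    have hn : α ^ 2 + ‖b‖ ^ 2 = 1 := by
      have := norm_add_sq_real (α • a) b
      rw [hx, norm_smul, real_inner_smul_left, hab, ha, Real.norm_eq_abs, mul_one, sq_abs] at this
      linarith
    have hα : |α| ≤ 1 := by
      rw [← sq_le_one_iff_abs_le_one]; nlinarith [sq_nonneg ‖b‖]
    have hb1 : ‖b‖ ≤ 1 := by nlinarith [sq_nonneg α, norm_nonneg b]
    have hTab : inner ℝ (T a) (T b) = 0 := by rw [horth, hab, mul_zero]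
    have hTx : ‖T (α • a + b)‖ ^ 2 ≤ ‖T a‖ ^ 2 - δ * ‖b‖ ^ 2 := by
      rw [map_add, map_smul, norm_add_sq_real, norm_smul, real_inner_smul_left, hTab, mul_pow,
        Real.norm_eq_abs, sq_abs]
      have := hgap b
      rw [hab] at this
      nlinarith
    have hbd : ∀ y z : E, ∀ k : ℝ, ‖y‖ ≤ 1 → ‖z‖ ≤ 1 → |k| * (‖y‖ * ‖z‖) ≤ ‖b‖ →
        k * inner ℝ (T y) (S z) ≤ ‖T‖ * ‖S‖ * ‖b‖ := by
      intro y z k _ _ hk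
      calc k * inner ℝ (T y) (S z) ≤ |k * inner ℝ (T y) (S z)| := le_abs_self _
        _ = |k| * |inner ℝ (T y) (S z)| := abs_mul _ _
        _ ≤ |k| * ((‖T‖ * ‖y‖) * (‖S‖ * ‖z‖)) := by
          gcongr
          exact (abs_real_inner_le_norm _ _).trans
            (mul_le_mul (T.le_opNorm y) (S.le_opNorm z) (norm_nonneg _) (by positivity))
        _ = ‖T‖ * ‖S‖ * (|k| * (‖y‖ * ‖z‖)) := by ring
        _ ≤ _ := by gcongr
    have hα0 := abs_nonneg α
    have hb0 := norm_nonneg b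
    have i1 := hbd a a (-‖b‖ ^ 2) ha.le ha.le (by rw [abs_neg, abs_pow, abs_norm, ha]; nlinarith)
    have i2 := hbd a b α ha.le hb1 (by rw [ha]; nlinarith)
    have i3 := hbd b a α hb1 ha.le (by rw [ha]; nlinarith)
    have i4 := hbd b b 1 hb1 hb1 (by rw [abs_one]; nlinarith)
    have hcross : inner ℝ (T (α • a + b)) (S (α • a + b)) ≤
        inner ℝ (T a) (S a) + 4 * (‖T‖ * ‖S‖ * ‖b‖) := by
      rw [map_add, map_smul, map_add, map_smul, inner_add_left, inner_add_right, inner_add_right,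
        real_inner_smul_left, real_inner_smul_left, real_inner_smul_right, real_inner_smul_right]
      have : α * (α * inner ℝ (T a) (S a)) =
          inner ℝ (T a) (S a) + (-‖b‖ ^ 2) * inner ℝ (T a) (S a) := by
        rw [← mul_assoc, ← sq, eq_sub_of_add_eq hn]; ring
      linarith
    have hSx : ‖S (α • a + b)‖ ^ 2 ≤ ‖S‖ ^ 2 := by
      have := S.le_opNorm (α • a + b)
      rw [hx, mul_one] at this
      gcongr
    have hyoung : 8 * (‖T‖ * ‖S‖ * ‖b‖) ≤ δ * ‖b‖ ^ 2 + 16 * ‖T‖ ^ 2 / δ * ‖S‖ ^ 2 := by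
      have : 0 ≤ (δ * ‖b‖ - 4 * (‖T‖ * ‖S‖)) ^ 2 / δ := by positivity
      have e : (δ * ‖b‖ - 4 * (‖T‖ * ‖S‖)) ^ 2 / δ =
          δ * ‖b‖ ^ 2 + 16 * ‖T‖ ^ 2 / δ * ‖S‖ ^ 2 - 8 * (‖T‖ * ‖S‖ * ‖b‖) := by
        field_simp; ring
      linarith
    rw [add_apply, norm_add_sq_real]
    linarith
  have hpos := (sq_nonneg _).trans (unit a ha)
  have := ContinuousLinearMap.opNorm_le_of_unit_norm (f := T + S) (Real.sqrt_nonneg _)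
    fun x hx => Real.le_sqrt_of_sq_le (unit x hx)
  calc ‖T + S‖ ^ 2 ≤ _ := pow_le_pow_left₀ (norm_nonneg _) this 2
    _ = _ := Real.sq_sqrt hpos

variable [CompleteSpace E] [CompleteSpace F]

lemma norm_apply_sq_le_of_isGreatest_eigenvalue [FiniteDimensional ℝ E] {T : E →L[ℝ] F} {lam : ℝ}
    (h : IsGreatest {μ : ℝ | Module.End.HasEigenvalue
      (((ContinuousLinearMap.adjoint T).comp T).toLinearMap : Module.End ℝ E) μ} lam) (b : E) :
    ‖T b‖ ^ 2 ≤ lam * ‖b‖ ^ 2 := by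
  rcases eq_or_ne b 0 with rfl | hb
  · simp
  have : Nontrivial E := ⟨b, 0, hb⟩
  have hsymm : (((ContinuousLinearMap.adjoint T).comp T).toLinearMap :
      Module.End ℝ E).IsSymmetric := by
    intro x y
    simp [ContinuousLinearMap.adjoint_inner_left, ContinuousLinearMap.adjoint_inner_right]
  have hsup := h.2 hsymm.hasEigenvalue_iSup_of_finiteDimensional
  have key : ∀ x : E, RCLike.re (inner ℝ ((ContinuousLinearMap.adjoint T) (T x)) x) = ‖T x‖ ^ 2 := by
    intro x
    rw [ContinuousLinearMap.adjoint_inner_left, real_inner_self_eq_norm_sq]; rfl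
  have hbdd : BddAbove (Set.range fun x : { x : E // x ≠ 0 } =>
      RCLike.re (inner ℝ ((ContinuousLinearMap.adjoint T) (T x)) (x : E)) / ‖(x : E)‖ ^ 2) := by
    refine ⟨‖T‖ ^ 2, ?_⟩
    rintro _ ⟨x, rfl⟩
    simp only [key]
    have hx : 0 < ‖(x : E)‖ ^ 2 := by have := norm_pos_iff.2 x.2; positivity
    rw [div_le_iff₀ hx, ← mul_pow]
    gcongr
    exact T.le_opNorm _
  have h1 := (le_ciSup hbdd ⟨b, hb⟩).trans hsup
  simp only [key] at h1
  have hb' : 0 < ‖b‖ ^ 2 := by have := norm_pos_iff.2 hb; positivity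
  rwa [div_le_iff₀ hb'] at h1

variable {T : E →L[ℝ] F} {a : E}

/-- Predicate on `T : E → F` and a unit vector `a`: the largest eigenvalue of `Tᵗ T` is simple and
`a` spans its eigenspace. -/
def IsTopDirection (T : E →L[ℝ] F) (a : E) : Prop :=
  ‖a‖ = 1 ∧ ∃ lam : ℝ, IsGreatest {μ : ℝ | Module.End.HasEigenvalue
      (((ContinuousLinearMap.adjoint T).comp T).toLinearMap : Module.End ℝ E) μ} lam ∧
    Module.End.eigenspace (((ContinuousLinearMap.adjoint T).comp T).toLinearMap : Module.End ℝ E)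
      lam = Submodule.span ℝ {a}

namespace IsTopDirection

lemma isGreatest (h : IsTopDirection T a) :
    IsGreatest {μ : ℝ | Module.End.HasEigenvalue
      (((ContinuousLinearMap.adjoint T).comp T).toLinearMap : Module.End ℝ E) μ} (‖T a‖ ^ 2) ∧
    Module.End.eigenspace (((ContinuousLinearMap.adjoint T).comp T).toLinearMap : Module.End ℝ E)
      (‖T a‖ ^ 2) = Submodule.span ℝ {a} := by
  obtain ⟨ha, lam, hg, hs⟩ := h
  have hmem : a ∈ Module.End.eigenspace (((ContinuousLinearMap.adjoint T).comp T).toLinearMap :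
      Module.End ℝ E) lam := hs ▸ Submodule.mem_span_singleton_self a
  have hG : (ContinuousLinearMap.adjoint T) (T a) = lam • a := Module.End.mem_eigenspace_iff.1 hmem
  have : ‖T a‖ ^ 2 = lam := by
    rw [← real_inner_self_eq_norm_sq, ← ContinuousLinearMap.adjoint_inner_left, hG,
      real_inner_smul_left, real_inner_self_eq_norm_sq, ha]
    simp
  rw [this]; exact ⟨hg, hs⟩

lemma inner_apply (h : IsTopDirection T a) (b : E) :
    inner ℝ (T a) (T b) = ‖T a‖ ^ 2 * inner ℝ a b := by
  have hmem : a ∈ Module.End.eigenspace (((ContinuousLinearMap.adjoint T).comp T).toLinearMap :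
      Module.End ℝ E) (‖T a‖ ^ 2) := h.isGreatest.2 ▸ Submodule.mem_span_singleton_self a
  have hG : (ContinuousLinearMap.adjoint T) (T a) = ‖T a‖ ^ 2 • a :=
    Module.End.mem_eigenspace_iff.1 hmem
  rw [← ContinuousLinearMap.adjoint_inner_left, hG, real_inner_smul_left]

lemma norm_apply_sq_le [FiniteDimensional ℝ E] (h : IsTopDirection T a) (b : E) :
    ‖T b‖ ^ 2 ≤ ‖T a‖ ^ 2 * ‖b‖ ^ 2 :=
  norm_apply_sq_le_of_isGreatest_eigenvalue h.isGreatest.1 b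

lemma opNorm_eq [FiniteDimensional ℝ E] (h : IsTopDirection T a) : ‖T‖ = ‖T a‖ := by
  apply le_antisymm
  · refine T.opNorm_le_bound (norm_nonneg _) fun b => ?_
    refine le_of_sq_le_sq ?_ (by positivity)
    rw [mul_pow]; exact h.norm_apply_sq_le b
  · simpa [h.1] using T.le_opNorm a

/-- Simplicity of the top eigenvalue, as positive definiteness of a form that depends continuously
on `T` and `a`. -/
lemma gap_pos [FiniteDimensional ℝ E] (h : IsTopDirection T a) {b : E} (hb : b ≠ 0) :
    0 < ‖T a‖ ^ 2 * ‖b‖ ^ 2 - ‖T b‖ ^ 2 + inner ℝ a b ^ 2 := by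
  by_contra! hle
  have h1 := h.norm_apply_sq_le b
  have h2 := sq_nonneg (inner ℝ a b)
  have hab : inner ℝ a b = 0 := pow_eq_zero_iff two_ne_zero |>.1 (by linarith)
  have hQ : ‖T a‖ ^ 2 * ‖b‖ ^ 2 = ‖T b‖ ^ 2 := by linarith
  -- a zero of a positive semidefinite form lies in its kernel
  have hB : ∀ c, ‖T a‖ ^ 2 * inner ℝ b c = inner ℝ (T b) (T c) := by
    intro c
    have hd : ∀ t : ℝ, 0 ≤ (‖T a‖ ^ 2 * ‖c‖ ^ 2 - ‖T c‖ ^ 2) * (t * t) +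
        2 * (‖T a‖ ^ 2 * inner ℝ b c - inner ℝ (T b) (T c)) * t + 0 := by
      intro t
      have := h.norm_apply_sq_le (b + t • c)
      rw [map_add, map_smul, norm_add_sq_real, norm_add_sq_real, norm_smul, norm_smul,
        real_inner_smul_right, real_inner_smul_right, mul_pow, mul_pow, Real.norm_eq_abs,
        sq_abs] at this
      nlinarith
    have := discrim_le_zero hd
    rw [discrim] at this
    have h0 : (‖T a‖ ^ 2 * inner ℝ b c - inner ℝ (T b) (T c)) ^ 2 ≤ 0 := by linarith
    have := pow_eq_zero_iff two_ne_zero |>.1 (le_antisymm h0 (sq_nonneg _))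
    linarith
  have hmem : b ∈ Module.End.eigenspace (((ContinuousLinearMap.adjoint T).comp T).toLinearMap :
      Module.End ℝ E) (‖T a‖ ^ 2) := by
    rw [Module.End.mem_eigenspace_iff]
    refine ext_inner_right ℝ fun c => ?_
    change inner ℝ ((ContinuousLinearMap.adjoint T) (T b)) c = _
    rw [ContinuousLinearMap.adjoint_inner_left, real_inner_smul_left, hB]
  rw [h.isGreatest.2, Submodule.mem_span_singleton] at hmem
  obtain ⟨k, rfl⟩ := hmem
  rw [real_inner_smul_right, real_inner_self_eq_norm_sq, h.1] at hab
  simp_all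

lemma apply_ne_zero [FiniteDimensional ℝ E] (h : IsTopDirection T a)
    (hE : 2 ≤ Module.finrank ℝ E) : T a ≠ 0 := by
  intro h0
  have hT : T = 0 := by rw [← norm_eq_zero, h.opNorm_eq, h0, norm_zero]
  have htop : Submodule.span ℝ {a} = ⊤ := by
    rw [← h.isGreatest.2, eq_top_iff]
    intro b _
    rw [Module.End.mem_eigenspace_iff, hT]
    simp
  have := finrank_span_le_card (R := ℝ) ({a} : Set E)
  rw [htop, finrank_top] at this
  simp at this
  omega

end IsTopDirection

end Spectral

/-! ### Tighter functions by first order perturbation -/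

/-- The gap of `IsTopDirection` is uniform on compact sets. -/
lemma exists_uniform_gap {E F : Type*} [NormedAddCommGroup E] [InnerProductSpace ℝ E]
    [FiniteDimensional ℝ E] [CompleteSpace E]
    [NormedAddCommGroup F] [InnerProductSpace ℝ F] [CompleteSpace F]
    {T : E → E →L[ℝ] F} {a : E → E} {K : Set E} (hK : IsCompact K) (hT : ContinuousOn T K)
    (ha : ContinuousOn a K) (htop : ∀ x ∈ K, IsTopDirection (T x) (a x)) :
    ∃ δ > 0, ∀ x ∈ K, ∀ b, δ * ‖b‖ ^ 2 ≤
      ‖T x (a x)‖ ^ 2 * ‖b‖ ^ 2 - ‖T x b‖ ^ 2 + inner ℝ (a x) b ^ 2 := by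
  have hcpt : IsCompact (K ×ˢ Metric.sphere (0 : E) 1) := hK.prod (isCompact_sphere 0 1)
  have hT' : ContinuousOn (fun p : E × E => T p.1) (K ×ˢ Metric.sphere (0 : E) 1) :=
    hT.comp continuousOn_fst fun p hp => hp.1
  have ha' : ContinuousOn (fun p : E × E => a p.1) (K ×ˢ Metric.sphere (0 : E) 1) :=
    ha.comp continuousOn_fst fun p hp => hp.1
  have hcont : ContinuousOn (fun p : E × E => ‖T p.1 (a p.1)‖ ^ 2 * ‖p.2‖ ^ 2
      - ‖T p.1 p.2‖ ^ 2 + inner ℝ (a p.1) p.2 ^ 2) (K ×ˢ Metric.sphere (0 : E) 1) :=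
    ((((hT'.clm_apply ha').norm.pow 2).mul (continuousOn_snd.norm.pow 2)).sub
      ((hT'.clm_apply continuousOn_snd).norm.pow 2)).add ((ha'.inner continuousOn_snd).pow 2)
  obtain ⟨δ, hδ, hle⟩ := hcpt.exists_forall_le' hcont (a := 0) fun p hp =>
    (htop p.1 hp.1).gap_pos (norm_ne_zero_iff.1 (by rw [mem_sphere_zero_iff_norm.1 hp.2]; simp))
  refine ⟨δ, hδ, fun x hx b => ?_⟩
  rcases eq_or_ne b 0 with rfl | hb
  · simp
  have hb' : ‖b‖ ≠ 0 := norm_ne_zero_iff.2 hb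
  have := hle (x, ‖b‖⁻¹ • b) ⟨hx, by simp [norm_smul, hb']⟩
  simp only [map_smul, norm_smul, real_inner_smul_right, mul_pow, norm_inv, norm_norm] at this
  have h2 := mul_le_mul_of_nonneg_right this (sq_nonneg ‖b‖)
  refine h2.trans_eq ?_
  field_simp

lemma IsPrincipalDirectionField.isTopDirection {n m : ℕ} {U : Set (EuclideanSpace ℝ (Fin n))}
    {u : EuclideanSpace ℝ (Fin n) → EuclideanSpace ℝ (Fin m)}
    {a : EuclideanSpace ℝ (Fin n) → EuclideanSpace ℝ (Fin n)}
    (ha : IsPrincipalDirectionField U u a) {x : EuclideanSpace ℝ (Fin n)} (hx : x ∈ U) :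
    IsTopDirection (fderiv ℝ u x) (a x) :=
  ⟨ha.norm_eq_one x hx, ha.eigenspace_eq_span x hx⟩

/-- If, on the part of `U` where `|Du|² > c`, moving in the direction `φ` decreases `|Du|²` to first
order at a rate that dominates `|Dφ|²`, then `u + ε φ` is tighter than `u` for small `ε > 0`. The
increase of the local Lipschitz constant where `|Du|² ≤ c` is harmless, being `O(ε)`. -/
lemma exists_isTighter_of_perturbation {n m : ℕ} {U : Set (EuclideanSpace ℝ (Fin n))}
    (hU : IsOpen U) {u φ : EuclideanSpace ℝ (Fin n) → EuclideanSpace ℝ (Fin m)}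
    (hu_lip : IsLipschitzOnClosure U u) (hu : ContDiffOn ℝ 1 u U)
    {a : EuclideanSpace ℝ (Fin n) → EuclideanSpace ℝ (Fin n)}
    (ha : IsPrincipalDirectionField U u a)
    (hφ : ContDiff ℝ 1 φ) (hφc : HasCompactSupport φ) (hφU : tsupport φ ⊆ U) {c C : ℝ} (hC : 0 < C)
    (hdec : ∀ x ∈ U, c < ‖fderiv ℝ u x (a x)‖ ^ 2 →
      ‖fderiv ℝ φ x‖ ^ 2 ≤ -C * inner ℝ (fderiv ℝ u x (a x)) (fderiv ℝ φ x (a x)))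
    {z : EuclideanSpace ℝ (Fin n)} (hz : z ∈ U) (hcz : c < ‖fderiv ℝ u z (a z)‖ ^ 2)
    (hneg : inner ℝ (fderiv ℝ u z (a z)) (fderiv ℝ φ z (a z)) < 0) :
    ∃ v, IsTighter U v u := by
  set T := fderiv ℝ u with hTdef
  set P := fderiv ℝ φ with hPdef
  have hTc : ContinuousOn T U := hu.continuousOn_fderiv_of_isOpen hU le_rfl
  obtain ⟨δ, hδ, hgap⟩ := exists_uniform_gap hφc (hTc.mono hφU) (ha.continuousOn.mono hφU)
    fun x hx => ha.isTopDirection (hφU hx)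
  obtain ⟨M₁, hM₁⟩ := hφc.exists_bound_of_continuousOn (hTc.mono hφU)
  obtain ⟨M₂, hM₂⟩ := (hφc.fderiv (𝕜 := ℝ)).exists_bound_of_continuous
    (hφ.continuous_fderiv one_ne_zero)
  have hP0 : ∀ x, x ∉ tsupport φ → P x = 0 := fun x hx => by
    have : x ∉ tsupport (fderiv ℝ φ) := fun h => hx (tsupport_fderiv_subset ℝ h)
    exact image_eq_zero_of_notMem_tsupport this
  have hzK : z ∈ tsupport φ := by
    by_contra h
    rw [hP0 z h] at hneg
    simp at hneg
  have hM₁0 : 0 ≤ M₁ := (norm_nonneg _).trans (hM₁ z hzK)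
  have hM₂0 : 0 ≤ M₂ := (norm_nonneg _).trans (hM₂ z)
  set s : EuclideanSpace ℝ (Fin n) → ℝ := fun x => ‖T x (a x)‖ ^ 2 with hs
  set i : EuclideanSpace ℝ (Fin n) → ℝ := fun x => inner ℝ (T x (a x)) (P x (a x)) with hi
  set Q : ℝ := 1 + 16 * M₁ ^ 2 / δ with hQ
  have hQ0 : 0 < Q := by positivity
  -- the bounds on `ε` serve, in order, the points with `|Du|² > c` and those with `|Du|² ≤ c`
  obtain ⟨ε, hε, hε1, hεC, hεM⟩ : ∃ ε : ℝ, 0 < ε ∧ ε ≤ 1 ∧ ε * (Q * C) ≤ 1 ∧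
      ε * (2 * (M₁ * M₂) + Q * M₂ ^ 2) ≤ (s z - c) / 2 := by
    have h0 : 0 < (s z - c) / 2 := by linarith [show c < s z from hcz]
    have hD : 0 < 2 * (M₁ * M₂) + Q * M₂ ^ 2 + 1 := by positivity
    refine ⟨min 1 (min (1 / (Q * C)) ((s z - c) / 2 / (2 * (M₁ * M₂) + Q * M₂ ^ 2 + 1))),
      by positivity, min_le_left _ _, ?_, ?_⟩
    · rw [← le_div_iff₀ (by positivity)]
      exact (min_le_right _ _).trans (min_le_left _ _)
    · have h1 : min 1 (min (1 / (Q * C)) ((s z - c) / 2 / (2 * (M₁ * M₂) + Q * M₂ ^ 2 + 1))) ≤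
        (s z - c) / 2 / (2 * (M₁ * M₂) + Q * M₂ ^ 2 + 1) :=
        (min_le_right _ _).trans (min_le_right _ _)
      rw [le_div_iff₀ hD] at h1
      have h2 : 0 < min 1 (min (1 / (Q * C)) ((s z - c) / 2 /
        (2 * (M₁ * M₂) + Q * M₂ ^ 2 + 1))) := by positivity
      linarith
  -- second order expansion of `|D(u + ε φ)|²`
  have hexp : ∀ x ∈ tsupport φ, ‖T x + ε • P x‖ ^ 2 ≤
      s x + 2 * (ε * i x) + Q * (ε ^ 2 * ‖P x‖ ^ 2) := by
    intro x hx
    have := norm_add_sq_le_of_gap (S := ε • P x) hδ (ha.norm_eq_one x (hφU hx))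
      (ha.isTopDirection (hφU hx)).inner_apply (hgap x hx)
    rw [norm_smul, mul_pow, Real.norm_eq_abs, sq_abs, smul_apply,
      real_inner_smul_right] at this
    refine this.trans ?_
    rw [hQ]
    gcongr
    exact hM₁ x hx
  have hhigh : ∀ x ∈ tsupport φ, c < s x → ‖T x + ε • P x‖ ^ 2 ≤ s x + ε * i x := by
    intro x hx hcx
    have h1 := hdec x (hφU hx) hcx
    have hi0 : i x ≤ 0 := by
      have := (sq_nonneg _).trans h1
      by_contra! h
      nlinarith [show 0 ≤ -C * i x from this]
    have h2 : Q * (ε ^ 2 * ‖P x‖ ^ 2) ≤ -(ε * i x) :=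
      calc Q * (ε ^ 2 * ‖P x‖ ^ 2) ≤ Q * (ε ^ 2 * (-C * i x)) := by gcongr
        _ = (ε * (Q * C)) * (ε * -i x) := by ring
        _ ≤ 1 * (ε * -i x) := by
          gcongr
          exact mul_nonneg hε.le (by linarith)
        _ = _ := by ring
    linarith [hexp x hx]
  have hlow : ∀ x ∈ tsupport φ, s x ≤ c → ‖T x + ε • P x‖ ^ 2 ≤ (c + s z) / 2 := by
    intro x hx hcx
    have hia : i x ≤ M₁ * M₂ := by
      refine (real_inner_le_norm _ _).trans ?_
      have h1 := (T x).le_opNorm (a x)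
      have h2 := (P x).le_opNorm (a x)
      rw [ha.norm_eq_one x (hφU hx), mul_one] at h1 h2
      exact mul_le_mul (h1.trans (hM₁ x hx)) (h2.trans (hM₂ x)) (norm_nonneg _) hM₁0
    have h3 : ε ^ 2 * ‖P x‖ ^ 2 ≤ ε * M₂ ^ 2 := by
      have : ε ^ 2 ≤ ε := by nlinarith
      have := hM₂ x
      gcongr
    have h4 := mul_le_mul_of_nonneg_left h3 hQ0.le
    have h5 := mul_le_mul_of_nonneg_left hia hε.le
    linarith [hexp x hx]
  have huat : ∀ x ∈ U, ContDiffAt ℝ 1 u x := fun x hx => hu.contDiffAt (hU.mem_nhds hx)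
  have hLu : ∀ x ∈ U, localLip U u x = ‖T x‖ₑ := fun x hx =>
    localLip_eq_enorm_fderiv hU hx (huat x hx)
  have hLv : ∀ x ∈ U, localLip U (u + ε • φ) x = ‖T x + ε • P x‖ₑ := by
    intro x hx
    have hd := ((huat x hx).differentiableAt one_ne_zero).hasFDerivAt.add
      ((hφ.differentiable one_ne_zero x).hasFDerivAt.const_smul ε)
    have hc : ContDiffAt ℝ 1 (u + ε • φ) x := (huat x hx).add (hφ.contDiffAt.const_smul ε)
    rw [localLip_eq_enorm_fderiv hU hx hc, hd.fderiv]
  have hTs : ∀ x ∈ U, ‖T x‖ ^ 2 = s x := fun x hx => by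
    rw [(ha.isTopDirection hx).opNorm_eq]
  have hlt_iff : ∀ A B : EuclideanSpace ℝ (Fin n) →L[ℝ] EuclideanSpace ℝ (Fin m),
      ‖A‖ₑ < ‖B‖ₑ ↔ ‖A‖ < ‖B‖ := fun A B => by
    rw [enorm_eq_nnnorm, enorm_eq_nnnorm, ENNReal.coe_lt_coe, ← NNReal.coe_lt_coe]
    rfl
  refine ⟨u + ε • φ, hu_lip, ?_, ?_, ?_⟩
  · obtain ⟨K, hK⟩ := hu_lip
    obtain ⟨K', hK'⟩ := ContDiff.lipschitzWith_of_hasCompactSupport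
      (hφc.smul_left (f := fun _ => ε)) (hφ.const_smul ε) one_ne_zero
    exact ⟨K + K', hK.add hK'.lipschitzOnWith⟩
  · intro x hx
    have : x ∉ tsupport φ := fun h => (hU.frontier_eq ▸ hx : x ∈ closure U \ U).2 (hφU h)
    simp [image_eq_zero_of_notMem_tsupport this]
  · have hsz : 0 < s z := by
      have : T z (a z) ≠ 0 := fun h => by simp [h] at hneg
      have := norm_pos_iff.2 this
      positivity
    refine lt_of_le_of_lt (b := ENNReal.ofReal √((c + s z) / 2)) ?_ ?_
    · refine iSup₂_le fun x ⟨hx, hgt⟩ => ?_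
      rw [hLu x hx, hLv x hx, gt_iff_lt, hlt_iff] at hgt
      rw [hLv x hx, ← ofReal_norm]
      have hxK : x ∈ tsupport φ := by
        by_contra h
        have h0 : ε • P x = 0 := by
          rw [← norm_eq_zero, norm_smul, hP0 x h, norm_zero, mul_zero]
        rw [h0, add_zero] at hgt
        exact lt_irrefl _ hgt
      apply ENNReal.ofReal_le_ofReal
      apply Real.le_sqrt_of_sq_le
      apply hlow x hxK
      by_contra! hcx
      have h1 := hhigh x hxK hcx
      have h2 := (sq_nonneg _).trans (hdec x hx hcx)
      have h3 : ‖T x‖ ^ 2 < ‖T x + ε • P x‖ ^ 2 := by gcongr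
      rw [hTs x hx] at h3
      nlinarith [show 0 ≤ -C * i x from h2]
    · have hlt : ENNReal.ofReal √((c + s z) / 2) < localLip U u z := by
        rw [hLu z hz, ← ofReal_norm, ENNReal.ofReal_lt_ofReal_iff_of_nonneg (Real.sqrt_nonneg _)]
        rw [Real.sqrt_lt' (lt_of_le_of_ne (norm_nonneg _) ?_), hTs z hz]
        · linarith [show c < s z from hcz]
        · intro h
          have := hTs z hz
          rw [← h] at this
          linarith [show (0:ℝ) ^ 2 = 0 by norm_num]
      refine hlt.trans_le (le_iSup₂_of_le z ⟨hz, ?_⟩ le_rfl)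
      rw [hLu z hz, hLv z hz, hlt_iff]
      refine lt_of_pow_lt_pow_left₀ 2 (norm_nonneg _) ?_
      rw [hTs z hz]
      have := hhigh z hzK hcz
      nlinarith [show i z < 0 from hneg]

lemma ContDiff.smul_of_tsupport_subset {E F : Type*} [NormedAddCommGroup E] [NormedSpace ℝ E]
    [NormedAddCommGroup F] [NormedSpace ℝ F] {k : WithTop ℕ∞} {U : Set E} (hU : IsOpen U)
    {f : E → ℝ} {g : E → F} (hf : ContDiff ℝ k f) (hfU : tsupport f ⊆ U)
    (hg : ContDiffOn ℝ k g U) : ContDiff ℝ k (fun x => f x • g x) := by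
  rw [contDiff_iff_contDiffAt]
  intro x
  by_cases hx : x ∈ U
  · exact hf.contDiffAt.smul (hg.contDiffAt (hU.mem_nhds hx))
  · have h0 : f =ᶠ[nhds x] 0 := notMem_tsupport_iff_eventuallyEq.1 fun h => hx (hfU h)
    refine contDiffAt_const (c := (0 : F)) |>.congr_of_eventuallyEq ?_
    filter_upwards [h0] with y hy
    simp [hy]

/-- `exists_isTighter_of_perturbation` for `φ = f g` with a scalar cutoff `f`. -/
lemma exists_isTighter_of_smul {n m : ℕ} {U : Set (EuclideanSpace ℝ (Fin n))}
    (hU : IsOpen U) {u g : EuclideanSpace ℝ (Fin n) → EuclideanSpace ℝ (Fin m)}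
    (hu_lip : IsLipschitzOnClosure U u) (hu : ContDiffOn ℝ 1 u U)
    {a : EuclideanSpace ℝ (Fin n) → EuclideanSpace ℝ (Fin n)}
    (ha : IsPrincipalDirectionField U u a) {f : EuclideanSpace ℝ (Fin n) → ℝ}
    (hf : ContDiff ℝ 1 f) (hfc : HasCompactSupport f) (hfU : tsupport f ⊆ U)
    (hg : ContDiffOn ℝ 1 g U) {c C : ℝ} (hC : 0 < C)
    (hdec : ∀ x ∈ U, c < ‖fderiv ℝ u x (a x)‖ ^ 2 →
      (|f x| * ‖fderiv ℝ g x‖ + ‖fderiv ℝ f x‖ * ‖g x‖) ^ 2 ≤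
        -C * (f x * inner ℝ (fderiv ℝ u x (a x)) (fderiv ℝ g x (a x)) +
          fderiv ℝ f x (a x) * inner ℝ (fderiv ℝ u x (a x)) (g x)))
    {z : EuclideanSpace ℝ (Fin n)} (hz : z ∈ U) (hcz : c < ‖fderiv ℝ u z (a z)‖ ^ 2)
    (hneg : f z * inner ℝ (fderiv ℝ u z (a z)) (fderiv ℝ g z (a z)) +
          fderiv ℝ f z (a z) * inner ℝ (fderiv ℝ u z (a z)) (g z) < 0) :
    ∃ v, IsTighter U v u := by
  have hd : ∀ x ∈ U, fderiv ℝ (fun x => f x • g x) x =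
      f x • fderiv ℝ g x + (fderiv ℝ f x).smulRight (g x) := fun x hx =>
    ((hf.differentiable one_ne_zero x).hasFDerivAt.smul
      ((hg.contDiffAt (hU.mem_nhds hx)).differentiableAt one_ne_zero).hasFDerivAt).fderiv
  have hi : ∀ x ∈ U, inner ℝ (fderiv ℝ u x (a x)) (fderiv ℝ (fun x => f x • g x) x (a x)) =
      f x * inner ℝ (fderiv ℝ u x (a x)) (fderiv ℝ g x (a x)) +
          fderiv ℝ f x (a x) * inner ℝ (fderiv ℝ u x (a x)) (g x) := fun x hx => by
    rw [hd x hx]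
    simp [inner_add_right, real_inner_smul_right]
  refine exists_isTighter_of_perturbation hU hu_lip hu ha (hf.smul_of_tsupport_subset hU hfU hg)
    hfc.smul_right ((tsupport_smul_subset_left f g).trans hfU) hC (fun x hx hcx => ?_) hz hcz ?_
  · rw [hi x hx, hd x hx]
    refine le_trans ?_ (hdec x hx hcx)
    gcongr
    refine (norm_add_le _ _).trans_eq ?_
    rw [norm_smul, ContinuousLinearMap.norm_smulRight_apply, Real.norm_eq_abs]
  · rwa [hi z hz]

/-! ### Constant speed along the flow -/

lemma ContDiffOn.derivAlong {n k : ℕ} {U : Set (EuclideanSpace ℝ (Fin n))} (hU : IsOpen U)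
    {a : EuclideanSpace ℝ (Fin n) → EuclideanSpace ℝ (Fin n)}
    {v : EuclideanSpace ℝ (Fin n) → EuclideanSpace ℝ (Fin k)} {i j : WithTop ℕ∞}
    (hv : ContDiffOn ℝ j v U) (ha : ContDiffOn ℝ i a U) (hij : i + 1 ≤ j) :
    ContDiffOn ℝ i (derivAlong a v) U :=
  (hv.fderiv_of_isOpen hU hij).clm_apply ha

lemma hasDerivAt_max_zero_sq (t : ℝ) :
    HasDerivAt (fun t : ℝ => max t 0 ^ 2) (2 * max t 0) t := by
  have hl : ∀ t ≤ 0, HasDerivWithinAt (fun t : ℝ => max t 0 ^ 2) (2 * max t 0) (Set.Iic 0) t := by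
    intro t ht
    refine ((hasDerivWithinAt_const t (Set.Iic 0) (0 : ℝ)).congr ?_ ?_).congr_deriv ?_
    · intro s hs
      simp [max_eq_right (Set.mem_Iic.1 hs)]
    · simp [max_eq_right ht]
    · simp [max_eq_right ht]
  have hr : ∀ t ≥ 0, HasDerivWithinAt (fun t : ℝ => max t 0 ^ 2) (2 * max t 0) (Set.Ici 0) t := by
    intro t ht
    refine (((hasDerivAt_pow 2 t).hasDerivWithinAt (s := Set.Ici 0)).congr ?_ ?_).congr_deriv ?_
    · intro s hs
      simp [max_eq_left (Set.mem_Ici.1 hs)]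
    · simp [max_eq_left ht]
    · simp [max_eq_left ht]
  rcases lt_trichotomy t 0 with ht | rfl | ht
  · exact (hl t ht.le).hasDerivAt (Iic_mem_nhds ht)
  · have := (hl 0 le_rfl).union (hr 0 le_rfl)
    rwa [Set.Iic_union_Ici, hasDerivWithinAt_univ] at this
  · exact (hr t ht.le).hasDerivAt (Ici_mem_nhds ht)

lemma contDiff_max_zero_sq : ContDiff ℝ 1 fun t : ℝ => max t 0 ^ 2 := by
  rw [contDiff_one_iff_deriv]
  refine ⟨fun t => (hasDerivAt_max_zero_sq t).differentiableAt, ?_⟩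
  rw [funext fun t => (hasDerivAt_max_zero_sq t).deriv]
  fun_prop

/-- If the speed `|u_a|` is constant along the flow of `a` but `(u_a)_a` does not vanish, a tighter
function is obtained by moving in the direction `(u_a)_a`: differentiating `u_a · (u_a)_a = 0`
along `a` gives `u_a · ((u_a)_a)_a = -|(u_a)_a|²`. -/
lemma exists_isTighter_of_inner_eq_zero {n m : ℕ} {U : Set (EuclideanSpace ℝ (Fin n))}
    (hU : IsOpen U) {u : EuclideanSpace ℝ (Fin n) → EuclideanSpace ℝ (Fin m)}
    (hu_lip : IsLipschitzOnClosure U u) (hu : ContDiffOn ℝ 3 u U)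
    {a : EuclideanSpace ℝ (Fin n) → EuclideanSpace ℝ (Fin n)}
    (ha : IsPrincipalDirectionField U u a) (ha_smooth : ContDiffOn ℝ 2 a U)
    (hinner : ∀ x ∈ U, inner ℝ (derivAlong a u x) (derivAlong a (derivAlong a u) x) = 0)
    {z : EuclideanSpace ℝ (Fin n)} (hz : z ∈ U) (hne : derivAlong a (derivAlong a u) z ≠ 0) :
    ∃ v, IsTighter U v u := by
  set w := derivAlong a u with hw
  set g := derivAlong a w with hg
  have hw2 : ContDiffOn ℝ 2 w U := hu.derivAlong hU ha_smooth (by norm_num)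
  have hg1 : ContDiffOn ℝ 1 g U := hw2.derivAlong hU (ha_smooth.of_le (by norm_num)) (by norm_num)
  have hgc : ContinuousOn g U := hg1.continuousOn
  have hDgc : ContinuousOn (fderiv ℝ g) U := hg1.continuousOn_fderiv_of_isOpen hU le_rfl
  have hwg : ∀ x ∈ U, inner ℝ (w x) (fderiv ℝ g x (a x)) = -‖g x‖ ^ 2 := by
    intro x hx
    have hxU := hU.mem_nhds hx
    have h0 : (fun y => inner ℝ (w y) (g y)) =ᶠ[nhds x] fun _ => (0 : ℝ) := by
      filter_upwards [hxU] with y hy using hinner y hy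
    have h1 := h0.fderiv_eq (𝕜 := ℝ)
    have h2 := fderiv_inner_apply (𝕜 := ℝ) ((hw2.contDiffAt hxU).differentiableAt two_ne_zero)
      ((hg1.contDiffAt hxU).differentiableAt one_ne_zero) (a x)
    rw [h1] at h2
    have h3 : fderiv ℝ w x (a x) = g x := rfl
    rw [h3, real_inner_self_eq_norm_sq] at h2
    simp at h2
    linarith
  set μ := ‖g z‖ / 2 with hμ
  have hμ0 : 0 < μ := by have := norm_pos_iff.2 hne; positivity
  obtain ⟨R, hR, hRU⟩ : ∃ R > 0, Metric.closedBall z R ⊆ U ∩ {x | μ < ‖g x‖} := by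
    refine Metric.nhds_basis_closedBall.mem_iff.1 (Filter.inter_mem (hU.mem_nhds hz) ?_)
    exact ((hgc.continuousAt (hU.mem_nhds hz)).norm).eventually
      (lt_mem_nhds (by rw [hμ]; linarith [norm_pos_iff.2 hne]))
  let ζ : ContDiffBump z := ⟨R / 2, R, by positivity, by linarith⟩
  have hK : IsCompact (Metric.closedBall z R) := isCompact_closedBall z R
  have hKU : Metric.closedBall z R ⊆ U := fun x hx => (hRU hx).1
  obtain ⟨M₁, hM₁⟩ := hK.exists_bound_of_continuousOn (hgc.mono hKU)
  obtain ⟨M₂, hM₂⟩ := hK.exists_bound_of_continuousOn (hDgc.mono hKU)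
  obtain ⟨M₃, hM₃⟩ := (ζ.hasCompactSupport.fderiv (𝕜 := ℝ)).exists_bound_of_continuous
    ((ζ.contDiff (n := 1)).continuous_fderiv one_ne_zero)
  have hzK : z ∈ Metric.closedBall z R := Metric.mem_closedBall_self hR.le
  have hM₁0 := (norm_nonneg _).trans (hM₁ z hzK)
  have hM₂0 := (norm_nonneg _).trans (hM₂ z hzK)
  have hM₃0 := (norm_nonneg _).trans (hM₃ z)
  have hDf : ∀ x, fderiv ℝ (fun x => ζ x ^ 2) x = (2 * ζ x) • fderiv ℝ ζ x := fun x => by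
    have := ((ζ.contDiff (n := 1)).differentiable one_ne_zero x).hasFDerivAt.pow 2
    rw [this.fderiv]; simp
  have hzero : ∀ x, x ∉ Metric.closedBall z R → ζ x = 0 := fun x hx =>
    ζ.zero_of_le_dist (le_of_lt (by simpa using hx))
  have hts : tsupport (fun x => ζ x ^ 2) ⊆ Metric.closedBall z R := by
    refine closure_minimal (fun x hx => ?_) Metric.isClosed_closedBall
    by_contra h
    simp [hzero x h] at hx
  refine exists_isTighter_of_smul (g := g) (f := fun x => ζ x ^ 2) (c := -1)
    (C := (M₂ + 2 * M₃ * M₁ + 1) ^ 2 / μ ^ 2) hU hu_lip (hu.of_le (by norm_num)) ha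
    (ζ.contDiff.pow 2) (HasCompactSupport.of_support_subset_isCompact hK
      (subset_closure.trans hts)) (hts.trans hKU) hg1 (by positivity) ?_ hz ?_ ?_
  · intro x hx _
    change _ ≤ -_ * (ζ x ^ 2 * inner ℝ (w x) (fderiv ℝ g x (a x)) + _ * inner ℝ (w x) (g x))
    rw [hwg x hx, hinner x hx, hDf, mul_zero, add_zero]
    by_cases hxK : x ∈ Metric.closedBall z R
    · have h1 := hM₁ x hxK
      have h2 := hM₂ x hxK
      have h3 := hM₃ x
      have hζ0 : 0 ≤ ζ x := ζ.nonneg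
      have hζ1 : ζ x ≤ 1 := ζ.le_one
      have h4 : |ζ x ^ 2| * ‖fderiv ℝ g x‖ + ‖(2 * ζ x) • fderiv ℝ ζ x‖ * ‖g x‖ ≤
          ζ x * (M₂ + 2 * M₃ * M₁ + 1) := by
        rw [norm_smul, Real.norm_eq_abs, abs_of_nonneg (sq_nonneg _),
          abs_of_nonneg (by positivity : 0 ≤ 2 * ζ x)]
        have e1 : ζ x ^ 2 * ‖fderiv ℝ g x‖ ≤ ζ x * M₂ := by
          have : ζ x ^ 2 ≤ ζ x := by nlinarith
          gcongr
        have e2 : 2 * ζ x * ‖fderiv ℝ ζ x‖ * ‖g x‖ ≤ 2 * ζ x * M₃ * M₁ := by gcongr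
        linarith
      have h5 : μ ^ 2 ≤ ‖g x‖ ^ 2 := by
        have := (hRU hxK).2
        simp only [Set.mem_ofPred_eq] at this
        gcongr
      calc _ ≤ (ζ x * (M₂ + 2 * M₃ * M₁ + 1)) ^ 2 := by gcongr
        _ = (M₂ + 2 * M₃ * M₁ + 1) ^ 2 / μ ^ 2 * (ζ x ^ 2 * μ ^ 2) := by field_simp
        _ ≤ (M₂ + 2 * M₃ * M₁ + 1) ^ 2 / μ ^ 2 * (ζ x ^ 2 * ‖g x‖ ^ 2) := by gcongr
        _ = _ := by ring
    · simp [hzero x hxK]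
  · exact lt_of_lt_of_le (by norm_num) (sq_nonneg _)
  · change ζ z ^ 2 * inner ℝ (w z) (fderiv ℝ g z (a z)) + _ * inner ℝ (w z) (g z) < 0
    have h1 : ζ z = 1 := ζ.one_of_mem_closedBall (Metric.mem_closedBall_self (by positivity))
    rw [hwg z hz, hinner z hz, h1]
    have := norm_pos_iff.2 hne
    simp only [one_pow, mul_zero, add_zero, one_mul]
    exact neg_neg_of_pos (by positivity)

/-! ### Varying speed along the flow -/

/-- If `|u_a|²` has nonzero derivative along the flow of `a` at `z`, a tighter function is obtained by
moving in the direction `e u_a`, where the sign `e = ±1` is that of the derivative, with a cutoff that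
decreases in the flow direction in which the speed increases. The cutoff is the square of the
positive part of `θ = κ - (|u_a|² - |u_a(z)|²) - |x - z|²`, times a bump function: where
`|u_a|² > |u_a(z)|² - κ`, the set `{θ > 0}` lies in a small ball around `z`, on which the bump
function is `1`. Elsewhere an increase of the local Lipschitz constant is allowed. -/
lemma exists_isTighter_of_inner_ne_zero {n m : ℕ} {U : Set (EuclideanSpace ℝ (Fin n))}
    (hU : IsOpen U) {u : EuclideanSpace ℝ (Fin n) → EuclideanSpace ℝ (Fin m)}
    (hu_lip : IsLipschitzOnClosure U u) (hu : ContDiffOn ℝ 3 u U)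
    {a : EuclideanSpace ℝ (Fin n) → EuclideanSpace ℝ (Fin n)}
    (ha : IsPrincipalDirectionField U u a) (ha_smooth : ContDiffOn ℝ 2 a U)
    {z : EuclideanSpace ℝ (Fin n)} (hz : z ∈ U)
    (hne : inner ℝ (derivAlong a u z) (derivAlong a (derivAlong a u) z) ≠ 0) :
    ∃ v, IsTighter U v u := by
  set w := derivAlong a u with hw
  have hw2 : ContDiffOn ℝ 2 w U := hu.derivAlong hU ha_smooth (by norm_num)
  set h : EuclideanSpace ℝ (Fin n) → ℝ := fun x => ‖w x‖ ^ 2 - ‖w z‖ ^ 2 + ‖x - z‖ ^ 2 with hh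
  have hh1 : ContDiffOn ℝ 1 h U :=
    (((hw2.of_le (by norm_num)).norm_sq ℝ).sub contDiffOn_const).add
      ((contDiffOn_id.sub contDiffOn_const).norm_sq ℝ)
  -- half the derivative of `|u_a|²` along `a`
  set p : EuclideanSpace ℝ (Fin n) → ℝ := fun x => inner ℝ (w x) (fderiv ℝ w x (a x)) with hp
  have hwd : ∀ x ∈ U, DifferentiableAt ℝ w x := fun x hx =>
    (hw2.contDiffAt (hU.mem_nhds hx)).differentiableAt two_ne_zero
  have hDh : ∀ x ∈ U, fderiv ℝ h x (a x) = 2 * p x + 2 * inner ℝ (x - z) (a x) := by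
    intro x hx
    have h1 := (((hwd x hx).hasFDerivAt.norm_sq).sub_const (‖w z‖ ^ 2)).add
      (((hasFDerivAt_id x).sub_const z).norm_sq)
    have h2 : fderiv ℝ h x = _ := h1.fderiv
    rw [h2]
    simp [hp, inner_sub_left]
  have hDwc : ContinuousOn (fderiv ℝ w) U := hw2.continuousOn_fderiv_of_isOpen hU (by norm_num)
  have hDhc : ContinuousOn (fderiv ℝ h) U := hh1.continuousOn_fderiv_of_isOpen hU le_rfl
  have hpc : ContinuousOn p U := hw2.continuousOn.inner (hDwc.clm_apply ha.continuousOn)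
  have hpz : 0 < |p z| := abs_pos.2 hne
  have hwz : 0 < ‖w z‖ ^ 2 := by
    have : w z ≠ 0 := fun h0 => hne (by rw [h0, inner_zero_left])
    have := norm_pos_iff.2 this
    positivity
  -- the sign `e` orients `a` in the direction of increasing speed
  obtain ⟨e, he, hez⟩ : ∃ e : ℝ, |e| = 1 ∧ e * p z = |p z| := by
    rcases abs_cases (p z) with ⟨h1, -⟩ | ⟨h1, -⟩
    · exact ⟨1, by simp, by rw [h1, one_mul]⟩
    · exact ⟨-1, by simp, by rw [h1]; ring⟩
  set σ := |p z| / 2 with hσ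
  have hσ0 : 0 < σ := by positivity
  set μ := ‖w z‖ ^ 2 / 2 with hμ
  have hμ0 : 0 < μ := by positivity
  obtain ⟨R, hR, hRσ, hRU⟩ : ∃ R > 0, R ≤ σ ∧
      Metric.closedBall z R ⊆ U ∩ ({x | σ < e * p x} ∩ {x | μ < ‖w x‖ ^ 2}) := by
    have hmem : U ∩ ({x | σ < e * p x} ∩ {x | μ < ‖w x‖ ^ 2}) ∈ nhds z := by
      have hzU := hU.mem_nhds hz
      refine Filter.inter_mem hzU (Filter.inter_mem ?_ ?_)
      · exact ((hpc.continuousAt hzU).const_mul e).eventually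
          (lt_mem_nhds (by change σ < e * p z; rw [hez, hσ]; linarith))
      · exact (((hw2.continuousOn.continuousAt hzU).norm).pow 2).eventually
          (lt_mem_nhds (by change μ < ‖w z‖ ^ 2; rw [hμ]; linarith))
    obtain ⟨R, hR, hsub⟩ := Metric.nhds_basis_closedBall.mem_iff.1 hmem
    exact ⟨min R σ, lt_min hR hσ0, min_le_right _ _,
      (Metric.closedBall_subset_closedBall (min_le_left _ _)).trans hsub⟩
  have hK : IsCompact (Metric.closedBall z R) := isCompact_closedBall z R
  have hKU : Metric.closedBall z R ⊆ U := fun x hx => (hRU hx).1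
  have hzK : z ∈ Metric.closedBall z R := Metric.mem_closedBall_self hR.le
  obtain ⟨M, hM0, hMw, hMDw, hMDh, hMp⟩ : ∃ M : ℝ, 0 < M ∧
      (∀ x ∈ Metric.closedBall z R, ‖w x‖ ≤ M) ∧
      (∀ x ∈ Metric.closedBall z R, ‖fderiv ℝ w x‖ ≤ M) ∧
      (∀ x ∈ Metric.closedBall z R, ‖fderiv ℝ h x‖ ≤ M) ∧
      (∀ x ∈ Metric.closedBall z R, |p x| ≤ M) := by
    obtain ⟨M₁, h₁⟩ := hK.exists_bound_of_continuousOn (hw2.continuousOn.mono hKU)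
    obtain ⟨M₂, h₂⟩ := hK.exists_bound_of_continuousOn (hDwc.mono hKU)
    obtain ⟨M₃, h₃⟩ := hK.exists_bound_of_continuousOn (hDhc.mono hKU)
    obtain ⟨M₄, h₄⟩ := hK.exists_bound_of_continuousOn (hpc.mono hKU)
    have := (norm_nonneg _).trans (h₁ z hzK)
    have := (norm_nonneg _).trans (h₂ z hzK)
    have := (norm_nonneg _).trans (h₃ z hzK)
    have := (norm_nonneg _).trans (h₄ z hzK)
    exact ⟨M₁ + M₂ + M₃ + M₄ + 1, by positivity, fun x hx => (h₁ x hx).trans (by linarith),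
      fun x hx => (h₂ x hx).trans (by linarith), fun x hx => (h₃ x hx).trans (by linarith),
      fun x hx => (h₄ x hx).trans (by linarith)⟩
  -- the first bound on `κ` confines `{θ > 0}` to the ball on which `ζ = 1`; the second makes the term
  -- `f w · w_a`, quadratic in `θ`, smaller than the gain `f_a |w|²`, linear in `θ`
  obtain ⟨κ, hκ0, hκR, hκM⟩ : ∃ κ : ℝ, 0 < κ ∧ 2 * κ < (R / 2) ^ 2 ∧ κ * (2 * M) ≤ σ * μ := by
    refine ⟨min (R ^ 2 / 16) (σ * μ / (2 * M)), by positivity, ?_, ?_⟩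
    · have := min_le_left (R ^ 2 / 16) (σ * μ / (2 * M))
      nlinarith [sq_pos_of_pos hR]
    · rw [← le_div_iff₀ (by positivity)]
      exact min_le_right _ _
  let ζ : ContDiffBump z := ⟨R / 2, R, by positivity, by linarith⟩
  have hζts : tsupport ζ = Metric.closedBall z R := ζ.tsupport_eq
  set f₀ : EuclideanSpace ℝ (Fin n) → ℝ := fun x => ζ x • max (κ - h x) 0 ^ 2 with hf₀
  set f : EuclideanSpace ℝ (Fin n) → ℝ := fun x => e * f₀ x with hf
  have hf₀1 : ContDiff ℝ 1 f₀ := ContDiff.smul_of_tsupport_subset hU ζ.contDiff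
    (hζts ▸ hKU) (contDiff_max_zero_sq.comp_contDiffOn (contDiffOn_const.sub hh1))
  have hts : tsupport f ⊆ Metric.closedBall z R := by
    refine closure_minimal (fun x hx => ?_) Metric.isClosed_closedBall
    by_contra hxK
    have : ζ x = 0 := ζ.zero_of_le_dist (le_of_lt (by simpa using hxK))
    simp [hf, hf₀, this] at hx
  have hmaxd : ∀ x ∈ U, HasFDerivAt (fun y => max (κ - h y) 0 ^ 2)
      ((2 * max (κ - h x) 0) • -fderiv ℝ h x) x := by
    intro x hx
    have := (hasDerivAt_max_zero_sq (κ - h x)).comp_hasFDerivAt x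
      (((hh1.contDiffAt (hU.mem_nhds hx)).differentiableAt one_ne_zero).hasFDerivAt.const_sub κ)
    exact this
  -- on the relevant side of the support the bump function `ζ` plays no role
  have hformula : ∀ x ∈ U, ‖w z‖ ^ 2 - κ < ‖w x‖ ^ 2 →
      f x = e * max (κ - h x) 0 ^ 2 ∧
      fderiv ℝ f x = (e * (2 * max (κ - h x) 0)) • -fderiv ℝ h x ∧
      (0 < κ - h x → dist x z < R / 2) := by
    intro x hx hcx
    have hd := ((((ζ.contDiff (n := 1)).differentiable one_ne_zero x).hasFDerivAt.smul
      (hmaxd x hx)).const_mul e).fderiv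
    rcases le_or_gt (κ - h x) 0 with hle | hlt
    · have h0 : max (κ - h x) 0 = 0 := max_eq_right hle
      refine ⟨by simp [hf, hf₀, h0], ?_, fun h1 => absurd h1 hle.not_gt⟩
      refine hd.trans ?_
      simp [h0]
    · have hdist : dist x z < R / 2 := by
        rw [dist_eq_norm]
        refine lt_of_pow_lt_pow_left₀ 2 (by positivity) (lt_of_le_of_lt ?_ hκR)
        simp only [hh] at hlt
        linarith
      have hζ1 : ζ =ᶠ[nhds x] 1 := ζ.eventuallyEq_one_of_mem_ball hdist
      have hζx : ζ x = 1 := hζ1.eq_of_nhds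
      have hζ' : fderiv ℝ ζ x = 0 := by rw [hζ1.fderiv_eq]; simp
      refine ⟨by simp [hf, hf₀, hζx], ?_, fun _ => hdist⟩
      refine hd.trans ?_
      rw [hζx, hζ']
      ext y
      simp
      ring
  clear_value p h
  -- the first order change of `|Du|²` and the size of `D(f w)` are both linear in `θ⁺`, so that the
  -- square of the latter is dominated by the former
  have hkey : ∀ x ∈ U, ‖w z‖ ^ 2 - κ < ‖w x‖ ^ 2 →
      f x * p x + fderiv ℝ f x (a x) * ‖w x‖ ^ 2 ≤ -(max (κ - h x) 0 * (σ * μ / 2)) ∧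
      |f x| * ‖fderiv ℝ w x‖ + ‖fderiv ℝ f x‖ * ‖w x‖ ≤
        max (κ - h x) 0 * (2 * κ * M + 2 * M * M) ∧ max (κ - h x) 0 ≤ 2 * κ := by
    intro x hx hcx
    obtain ⟨e1, e2, hdist⟩ := hformula x hx hcx
    rcases le_or_gt (κ - h x) 0 with hle | hlt
    · have h0 : max (κ - h x) 0 = 0 := max_eq_right hle
      rw [e1, e2, h0]
      simp [hκ0.le]
    have hxz := hdist hlt
    have hxK : x ∈ Metric.closedBall z R := (hxz.trans (by linarith)).le
    rw [e1, e2]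
    rw [max_eq_left hlt.le]
    have hθκ : κ - h x ≤ 2 * κ := by
      simp only [hh]
      linarith [sq_nonneg ‖x - z‖]
    generalize κ - h x = θ at hlt hθκ ⊢
    have hσx : σ < e * p x := (hRU hxK).2.1
    have hμx : μ < ‖w x‖ ^ 2 := (hRU hxK).2.2
    have h1 := hMw x hxK
    have h2 := hMDw x hxK
    have h3 := hMDh x hxK
    have h4 := hMp x hxK
    refine ⟨?_, ?_, hθκ⟩
    · have hin : -(e * inner ℝ (x - z) (a x)) ≤ σ / 2 := by
        have : |e * inner ℝ (x - z) (a x)| ≤ ‖x - z‖ := by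
          rw [abs_mul, he, one_mul]
          simpa [ha.norm_eq_one x hx] using abs_real_inner_le_norm (x - z) (a x)
        rw [dist_eq_norm] at hxz
        linarith [neg_abs_le (e * inner ℝ (x - z) (a x))]
      have hDf : ((e * (2 * θ)) • -fderiv ℝ h x) (a x) ≤ -(2 * θ * σ) := by
        have : ((e * (2 * θ)) • -fderiv ℝ h x) (a x) =
            -(2 * θ * (2 * (e * p x) + 2 * (e * inner ℝ (x - z) (a x)))) := by
          simp only [smul_apply, neg_apply, smul_eq_mul, hDh x hx]
          ring
        rw [this]
        have : 2 * θ * σ ≤ 2 * θ * (2 * (e * p x) + 2 * (e * inner ℝ (x - z) (a x))) := by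
          gcongr
          linarith
        linarith
      have t1 : e * θ ^ 2 * p x ≤ θ * (σ * μ) := by
        have : e * p x ≤ M := by
          have := le_abs_self (e * p x)
          rw [abs_mul, he, one_mul] at this
          linarith
        calc e * θ ^ 2 * p x = θ * (θ * (e * p x)) := by ring
          _ ≤ θ * (2 * κ * M) := by
            have : 0 ≤ e * p x := (hσ0.trans hσx).le
            gcongr
          _ ≤ θ * (σ * μ) := mul_le_mul_of_nonneg_left (by linarith) hlt.le
      have t2 : ((e * (2 * θ)) • -fderiv ℝ h x) (a x) * ‖w x‖ ^ 2 ≤ -(2 * θ * σ) * μ := by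
        have s1 := mul_le_mul_of_nonneg_right hDf (sq_nonneg ‖w x‖)
        have s2 : 2 * θ * σ * μ ≤ 2 * θ * σ * ‖w x‖ ^ 2 := by gcongr
        linarith
      have : 0 < θ * (σ * μ) := by positivity
      nlinarith
    · have n1 : |e * θ ^ 2| = θ ^ 2 := by
        rw [abs_mul, he, one_mul, abs_of_nonneg (sq_nonneg _)]
      have n2 : ‖(e * (2 * θ)) • -fderiv ℝ h x‖ = 2 * θ * ‖fderiv ℝ h x‖ := by
        rw [norm_smul, norm_neg, Real.norm_eq_abs, abs_mul, he, one_mul,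
          abs_of_nonneg (by positivity)]
      rw [n1, n2]
      calc θ ^ 2 * ‖fderiv ℝ w x‖ + 2 * θ * ‖fderiv ℝ h x‖ * ‖w x‖
          = θ * (θ * ‖fderiv ℝ w x‖ + 2 * ‖fderiv ℝ h x‖ * ‖w x‖) := by ring
        _ ≤ _ := by gcongr
  have hinner_self : ∀ x, inner ℝ (fderiv ℝ u x (a x)) (w x) = ‖w x‖ ^ 2 := fun x =>
    real_inner_self_eq_norm_sq (w x)
  have hinner_deriv : ∀ x, inner ℝ (fderiv ℝ u x (a x)) (fderiv ℝ w x (a x)) = p x := fun x => by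
    rw [hp]; rfl
  refine exists_isTighter_of_smul (g := w) (f := f) (c := ‖w z‖ ^ 2 - κ)
    (C := 2 * κ * (2 * κ * M + 2 * M * M) ^ 2 / (σ * μ / 2)) hU hu_lip
    (hu.of_le (by norm_num)) ha (contDiff_const.mul hf₀1)
    (HasCompactSupport.of_support_subset_isCompact hK (subset_closure.trans hts)) (hts.trans hKU)
    (hw2.of_le (by norm_num)) (by positivity) ?_ hz ?_ ?_
  · intro x hx hcx
    obtain ⟨k1, k2, k3⟩ := hkey x hx hcx
    rw [hinner_self, hinner_deriv]
    have hθ0 : 0 ≤ max (κ - h x) 0 := le_max_right _ _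
    generalize max (κ - h x) 0 = θ at k1 k2 k3 hθ0
    calc _ ≤ (θ * (2 * κ * M + 2 * M * M)) ^ 2 := by gcongr
      _ = θ * (θ * (2 * κ * M + 2 * M * M) ^ 2) := by ring
      _ ≤ θ * (2 * κ * (2 * κ * M + 2 * M * M) ^ 2) := by gcongr
      _ = 2 * κ * (2 * κ * M + 2 * M * M) ^ 2 / (σ * μ / 2) * (θ * (σ * μ / 2)) := by
        field_simp
      _ ≤ 2 * κ * (2 * κ * M + 2 * M * M) ^ 2 / (σ * μ / 2) *
          -(f x * p x + fderiv ℝ f x (a x) * ‖w x‖ ^ 2) := by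
        gcongr
        linarith
      _ = _ := by ring
  · change _ < ‖w z‖ ^ 2
    linarith
  · rw [hinner_self, hinner_deriv]
    have k1 := (hkey z hz (by linarith)).1
    have hhz : h z = 0 := by simp [hh]
    rw [hhz, sub_zero, max_eq_left hκ0.le] at k1
    have : 0 < κ * (σ * μ / 2) := by positivity
    linarith

/-! ### Flow curves -/

section FlowArcs

open Filter Topology

variable {n : ℕ} {U : Set (EuclideanSpace ℝ (Fin n))}
  {a : EuclideanSpace ℝ (Fin n) → EuclideanSpace ℝ (Fin n)}
  {I : Set ℝ} {γ : ℝ → EuclideanSpace ℝ (Fin n)}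

lemma IsFlowArc.hasDerivAt (h : IsFlowArc U a I γ) {t : ℝ} (ht : t ∈ I) :
    HasDerivAt γ (a (γ t)) t :=
  (h.isIntegralCurveOn t ht).hasDerivAt (h.isOpen.mem_nhds ht)

lemma IsFlowArc.lipschitzOnWith (h : IsFlowArc U a I γ) (ha : ∀ x ∈ U, ‖a x‖ = 1) :
    LipschitzOnWith 1 γ I :=
  h.ordConnected.convex.lipschitzOnWith_of_nnnorm_hasDerivWithin_le h.isIntegralCurveOn
    fun t ht => by rw [← NNReal.coe_le_coe]; exact (ha _ (h.mem t ht)).le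

/-- Every flow arc extends to a flow curve. Zorn's lemma gives this without uniqueness of solutions:
in a chain, any two arcs agree on their common domain. -/
lemma IsFlowArc.exists_isFlowCurve (h : IsFlowArc U a I γ) :
    ∃ J δ, IsFlowCurve U a J δ ∧ I ⊆ J ∧ Set.EqOn δ γ I := by
  classical
  let α := {p : Set ℝ × (ℝ → EuclideanSpace ℝ (Fin n)) //
    IsFlowArc U a p.1 p.2 ∧ I ⊆ p.1 ∧ Set.EqOn p.2 γ I}
  let r : α → α → Prop := fun p q => p.1.1 ⊆ q.1.1 ∧ Set.EqOn q.1.2 p.1.2 p.1.1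
  have hne : Nonempty α := ⟨⟨(I, γ), h, subset_rfl, fun _ _ => rfl⟩⟩
  obtain ⟨⟨⟨J, δ⟩, hJ, hIJ, hδ⟩, hmax⟩ : ∃ p, ∀ q, r p q → r q p := by
    refine exists_maximal_of_nonempty_chains_bounded (r := r) (fun c hc hcne => ?_)
      fun h1 h2 => ⟨h1.1.trans h2.1, fun t ht => (h2.2 (h1.1 ht)).trans (h1.2 ht)⟩
    let δ : ℝ → EuclideanSpace ℝ (Fin n) := fun t =>
      if ht : ∃ p ∈ c, t ∈ p.1.1 then ht.choose.1.2 t else 0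
    have hδ : ∀ p ∈ c, Set.EqOn δ p.1.2 p.1.1 := by
      intro p hp t htp
      have ht : ∃ p ∈ c, t ∈ p.1.1 := ⟨p, hp, htp⟩
      have hδt : δ t = ht.choose.1.2 t := dif_pos ht
      rw [hδt]
      obtain ⟨hq, htq⟩ := ht.choose_spec
      rcases eq_or_ne ht.choose p with he | hne
      · rw [he]
      · rcases hc hq hp hne with h1 | h1
        · exact (h1.2 htq).symm
        · exact h1.2 htp
    have hmem : ∀ t, t ∈ ⋃ p ∈ c, p.1.1 ↔ ∃ p ∈ c, t ∈ p.1.1 := fun t => by simp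
    have harc : IsFlowArc U a (⋃ p ∈ c, p.1.1) δ := by
      refine ⟨isOpen_biUnion fun p _ => p.2.1.isOpen, ⟨fun s hs t ht => ?_⟩, ?_, fun t ht => ?_,
        fun t ht => ?_⟩
      · obtain ⟨p, hp, hsp⟩ := (hmem s).1 hs
        obtain ⟨q, hq, htq⟩ := (hmem t).1 ht
        rcases eq_or_ne p q with rfl | hpq
        · exact (p.2.1.ordConnected.out hsp htq).trans
            (Set.subset_biUnion_of_mem (u := fun p : α => p.1.1) hp)
        · rcases hc hp hq hpq with h1 | h1
          · exact (q.2.1.ordConnected.out (h1.1 hsp) htq).trans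
              (Set.subset_biUnion_of_mem (u := fun p : α => p.1.1) hq)
          · exact (p.2.1.ordConnected.out hsp (h1.1 htq)).trans
              (Set.subset_biUnion_of_mem (u := fun p : α => p.1.1) hp)
      · obtain ⟨p, hp⟩ := hcne
        obtain ⟨t, ht⟩ := p.2.1.nonempty
        exact ⟨t, (hmem t).2 ⟨p, hp, ht⟩⟩
      · obtain ⟨p, hp, htp⟩ := (hmem t).1 ht
        rw [hδ p hp htp]
        exact p.2.1.mem t htp
      · obtain ⟨p, hp, htp⟩ := (hmem t).1 ht
        have he : δ =ᶠ[𝓝 t] p.1.2 := (hδ p hp).eventuallyEq_of_mem (p.2.1.isOpen.mem_nhds htp)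
        rw [hδ p hp htp]
        exact ((p.2.1.hasDerivAt htp).congr_of_eventuallyEq he).hasDerivWithinAt
    obtain ⟨p, hp⟩ := hcne
    refine ⟨⟨(⋃ p ∈ c, p.1.1, δ), harc, p.2.2.1.trans
      (Set.subset_biUnion_of_mem (u := fun p : α => p.1.1) hp), fun t ht => ?_⟩, fun q hq =>
        ⟨Set.subset_biUnion_of_mem (u := fun p : α => p.1.1) hq, hδ q hq⟩⟩
    exact (hδ p hp (p.2.2.1 ht)).trans (p.2.2.2 ht)
  refine ⟨J, δ, ⟨hJ, fun J' δ' hJ' hJJ' hδ' => ?_⟩, hIJ, hδ⟩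
  exact (hmax ⟨(J', δ'), hJ', hIJ.trans hJJ', fun t ht => (hδ' (hIJ ht)).trans (hδ ht)⟩
    ⟨hJJ', hδ'⟩).1.antisymm hJJ'

lemma exists_isFlowArc_of_mem (hU : IsOpen U) (ha : ContDiffOn ℝ 1 a U)
    {x : EuclideanSpace ℝ (Fin n)} (hx : x ∈ U) (t₀ : ℝ) :
    ∃ ε > 0, ∃ γ, γ t₀ = x ∧ IsFlowArc U a (Set.Ioo (t₀ - ε) (t₀ + ε)) γ := by
  obtain ⟨γ, hγ0, ε, hε, hγ⟩ :=
    ContDiffAt.exists_forall_mem_closedBall_exists_eq_forall_mem_Ioo_hasDerivAt₀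
      (ha.contDiffAt (hU.mem_nhds hx)) t₀
  have hγc : ContinuousAt γ t₀ := (hγ t₀ ⟨by linarith, by linarith⟩).continuousAt
  obtain ⟨ρ, hρ, hρU⟩ := Metric.mem_nhds_iff.1 (hγc (hγ0.symm ▸ hU.mem_nhds hx))
  have hsub : Set.Ioo (t₀ - min ε ρ) (t₀ + min ε ρ) ⊆ Set.Ioo (t₀ - ε) (t₀ + ε) :=
    Set.Ioo_subset_Ioo (by linarith [min_le_left ε ρ]) (by linarith [min_le_left ε ρ])
  have hmin : 0 < min ε ρ := lt_min hε hρ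
  refine ⟨min ε ρ, hmin, γ, hγ0, isOpen_Ioo, Set.ordConnected_Ioo,
    ⟨t₀, by linarith, by linarith⟩, fun t ht => hρU ?_,
    fun t ht => (hγ t (hsub ht)).hasDerivWithinAt⟩
  rw [Real.ball_eq_Ioo]
  exact Set.Ioo_subset_Ioo (by linarith [min_le_right ε ρ]) (by linarith [min_le_right ε ρ]) ht

lemma exists_isFlowCurve_of_mem (hU : IsOpen U) (ha : ContDiffOn ℝ 1 a U)
    {x : EuclideanSpace ℝ (Fin n)} (hx : x ∈ U) :
    ∃ I γ, IsFlowCurve U a I γ ∧ ∃ t ∈ I, γ t = x := by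
  obtain ⟨ε, hε, γ, hγ0, hγ⟩ := exists_isFlowArc_of_mem hU ha hx 0
  obtain ⟨J, δ, hδ, hsub, heq⟩ := hγ.exists_isFlowCurve
  have h0 : (0 : ℝ) ∈ Set.Ioo (0 - ε) (0 + ε) := ⟨by linarith, by linarith⟩
  exact ⟨J, δ, hδ, 0, hsub h0, (heq h0).trans hγ0⟩

lemma IsFlowArc.comp_neg (h : IsFlowArc U a I γ) :
    IsFlowArc U (-a) (Neg.neg ⁻¹' I) (fun t => γ (-t)) := by
  refine ⟨h.isOpen.preimage continuous_neg, ⟨fun s hs t ht r hr => ?_⟩, ?_,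
    fun t ht => h.mem _ ht, fun t ht => ?_⟩
  · exact h.ordConnected.out ht hs ⟨neg_le_neg hr.2, neg_le_neg hr.1⟩
  · obtain ⟨t, ht⟩ := h.nonempty
    exact ⟨-t, by simpa using ht⟩
  · have := (h.hasDerivAt (show -t ∈ I from ht)).scomp t (hasDerivAt_neg t)
    simpa [Function.comp_def] using this.hasDerivWithinAt

lemma IsFlowCurve.comp_neg (h : IsFlowCurve U a I γ) :
    IsFlowCurve U (-a) (Neg.neg ⁻¹' I) (fun t => γ (-t)) := by
  refine ⟨h.1.comp_neg, fun J δ hδ hIJ heq => ?_⟩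
  have h1 := hδ.comp_neg
  rw [neg_neg] at h1
  have h2 := h.2 _ _ h1 (fun t ht => hIJ (by simpa using ht)) fun t ht => by
    simpa using heq (show -t ∈ Neg.neg ⁻¹' I by simpa using ht)
  rw [← h2, ← Set.preimage_comp]
  simp

/-- A flow curve that converges to a point at the right end of its interval leaves `U` there. -/
lemma IsFlowCurve.notMem_of_tendsto_right (hU : IsOpen U) (ha : ContDiffOn ℝ 1 a U) {α β : ℝ}
    (hαβ : α < β) (h : IsFlowCurve U a (Set.Ioo α β) γ) {y : EuclideanSpace ℝ (Fin n)}
    (hy : Tendsto γ (𝓝[<] β) (𝓝 y)) : y ∉ U := by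
  intro hyU
  obtain ⟨ε, hε, η, hηβ, hη⟩ := exists_isFlowArc_of_mem hU ha hyU β
  set δ : ℝ → EuclideanSpace ℝ (Fin n) := fun t => if t < β then γ t else η t with hδ
  have hδl : ∀ t < β, δ t = γ t := fun t ht => if_pos ht
  have hδr : ∀ t, β ≤ t → δ t = η t := fun t ht => if_neg ht.not_gt
  have hIio : Set.Ioo α β ∈ 𝓝[<] β := Ioo_mem_nhdsLT hαβ
  have hd : ∀ t ∈ Set.Ioo α β, HasDerivAt δ (a (γ t)) t := fun t ht =>
    (h.1.hasDerivAt ht).congr_of_eventuallyEq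
      (by filter_upwards [Iio_mem_nhds ht.2] with s hs using hδl s hs)
  have hδβ : δ β = y := (hδr β le_rfl).trans hηβ
  have harc : IsFlowArc U a (Set.Ioo α (β + ε)) δ := by
    refine ⟨isOpen_Ioo, Set.ordConnected_Ioo, ⟨β, hαβ, by linarith⟩, fun t ht => ?_, fun t ht => ?_⟩
    · rcases lt_or_ge t β with htβ | htβ
      · rw [hδl t htβ]; exact h.1.mem t ⟨ht.1, htβ⟩
      · rw [hδr t htβ]; exact hη.mem t ⟨by linarith, ht.2⟩
    · apply HasDerivAt.hasDerivWithinAt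
      rcases lt_trichotomy t β with htβ | rfl | htβ
      · rw [hδl t htβ]; exact hd t ⟨ht.1, htβ⟩
      · have hl : HasDerivWithinAt δ (a y) (Set.Iic t) t := by
          refine hasDerivWithinAt_Iic_of_tendsto_deriv (s := Set.Ioo α t)
            (fun s hs => (hd s hs).differentiableAt.differentiableWithinAt) ?_ hIio ?_
          · rw [ContinuousWithinAt, hδβ]
            refine (hy.mono_left (nhdsWithin_mono _ Set.Ioo_subset_Iio_self)).congr' ?_
            filter_upwards [self_mem_nhdsWithin] with s hs using (hδl s hs.2).symm
          · have hac : ContinuousAt a y := ha.continuousOn.continuousAt (hU.mem_nhds hyU)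
            refine (hac.tendsto.comp hy).congr' ?_
            filter_upwards [hIio] with s hs using (hd s hs).deriv.symm
        have hr : HasDerivWithinAt δ (a y) (Set.Ici t) t := by
          have := (hη.hasDerivAt (t := t) ⟨by linarith, by linarith⟩).hasDerivWithinAt
            (s := Set.Ici t)
          rw [hηβ] at this
          exact this.congr (fun s hs => hδr s hs) (hδr t le_rfl)
        have := hl.union hr
        rw [Set.Iic_union_Ici, hasDerivWithinAt_univ] at this
        rwa [hδβ]
      · rw [hδr t htβ.le]
        exact (hη.hasDerivAt ⟨by linarith, ht.2⟩).congr_of_eventuallyEq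
          (by filter_upwards [Ioi_mem_nhds htβ] with s hs using hδr s (le_of_lt hs))
  have heq := h.2 _ _ harc (Set.Ioo_subset_Ioo_right (by linarith)) fun t ht => hδl t ht.2
  have : β ∈ Set.Ioo α β := heq ▸ ⟨hαβ, by linarith⟩
  exact lt_irrefl _ this.2

lemma IsFlowCurve.notMem_of_tendsto_left (hU : IsOpen U) (ha : ContDiffOn ℝ 1 a U) {α β : ℝ}
    (hαβ : α < β) (h : IsFlowCurve U a (Set.Ioo α β) γ) {y : EuclideanSpace ℝ (Fin n)}
    (hy : Tendsto γ (𝓝[>] α) (𝓝 y)) : y ∉ U := by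
  have h1 := h.comp_neg
  have he : Neg.neg ⁻¹' Set.Ioo α β = Set.Ioo (-β) (-α) := by simp
  rw [he] at h1
  refine h1.notMem_of_tendsto_right hU ha.neg (by linarith) (hy.comp ?_)
  have := tendsto_neg_nhdsLT (a := -α)
  rwa [neg_neg] at this

end FlowArcs

lemma IsOpen.exists_eq_Ioo_of_isBounded {I : Set ℝ} (hI : IsOpen I) (hc : I.OrdConnected)
    (hne : I.Nonempty) (hb : Bornology.IsBounded I) : ∃ α β, α < β ∧ I = Set.Ioo α β := by
  have hbb := isBounded_iff_bddBelow_bddAbove.1 hb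
  have hI' : I = Set.Ioo (sInf I) (sSup I) := by
    ext t
    constructor
    · intro ht
      obtain ⟨ε, hε, hsub⟩ := Metric.isOpen_iff.1 hI t ht
      rw [Real.ball_eq_Ioo] at hsub
      have h1 := csInf_le hbb.1 (hsub ⟨by linarith, by linarith⟩ : t - ε / 2 ∈ I)
      have h2 := le_csSup hbb.2 (hsub ⟨by linarith, by linarith⟩ : t + ε / 2 ∈ I)
      exact ⟨by linarith, by linarith⟩
    · intro ht
      obtain ⟨s, hs, hst⟩ := exists_lt_of_csInf_lt hne ht.1
      obtain ⟨r, hr, htr⟩ := exists_lt_of_lt_csSup hne ht.2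
      exact hc.out hs hr ⟨hst.le, htr.le⟩
  refine ⟨sInf I, sSup I, ?_, hI'⟩
  obtain ⟨t, ht⟩ := hne
  rw [hI'] at ht
  exact ht.1.trans ht.2

/-! ### Straight lines and tightness -/

section Lines

variable {n m : ℕ} {U : Set (EuclideanSpace ℝ (Fin n))}
  {u : EuclideanSpace ℝ (Fin n) → EuclideanSpace ℝ (Fin m)}
  {a : EuclideanSpace ℝ (Fin n) → EuclideanSpace ℝ (Fin n)}
  {I : Set ℝ} {γ : ℝ → EuclideanSpace ℝ (Fin n)}

lemma IsFlowArc.hasDerivAt_comp {k : ℕ} {f : EuclideanSpace ℝ (Fin n) → EuclideanSpace ℝ (Fin k)}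
    (h : IsFlowArc U a I γ) (hU : IsOpen U) (hf : DifferentiableOn ℝ f U) {t : ℝ} (ht : t ∈ I) :
    HasDerivAt (fun s => f (γ s)) (derivAlong a f (γ t)) t :=
  ((hf.differentiableAt (hU.mem_nhds (h.mem t ht))).hasFDerivAt).comp_hasDerivAt t (h.hasDerivAt ht)

/-- A map with `(u_a)_a = 0` has the constant velocity `u_a` along flow arcs. -/
lemma IsFlowArc.exists_eq_line (h : IsFlowArc U a I γ) (hU : IsOpen U)
    (hu : DifferentiableOn ℝ u U) (hua : DifferentiableOn ℝ (derivAlong a u) U)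
    (heq : ∀ x ∈ U, derivAlong a (derivAlong a u) x = 0) :
    ∃ p q : EuclideanSpace ℝ (Fin m), ∀ t ∈ I, derivAlong a u (γ t) = q ∧ u (γ t) = p + t • q := by
  have hpre : IsPreconnected I := h.ordConnected.isPreconnected
  obtain ⟨q, hq⟩ := h.isOpen.exists_is_const_of_deriv_eq_zero hpre
    (fun t ht => (h.hasDerivAt_comp hU hua ht).differentiableAt.differentiableWithinAt)
    (fun t ht => by rw [(h.hasDerivAt_comp hU hua ht).deriv, heq _ (h.mem t ht)]; rfl)
  have hd : ∀ t ∈ I, HasDerivAt (fun s => u (γ s) - s • q) 0 t := fun t ht => by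
    have := (h.hasDerivAt_comp hU hu ht).sub ((hasDerivAt_id t).smul_const q)
    rw [hq t ht, one_smul, sub_self] at this
    exact this
  obtain ⟨p, hp⟩ := h.isOpen.exists_is_const_of_deriv_eq_zero hpre
    (fun t ht => (hd t ht).differentiableAt.differentiableWithinAt) fun t ht => (hd t ht).deriv
  exact ⟨p, q, fun t ht => ⟨hq t ht, by rw [← hp t ht]; abel⟩⟩

lemma forall_derivAlong_eq_zero_iff (hU : IsOpen U) (hu : DifferentiableOn ℝ u U)
    (hua : DifferentiableOn ℝ (derivAlong a u) U) (ha : IsPrincipalDirectionField U u a)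
    (ha_smooth : ContDiffOn ℝ 1 a U) :
    (∀ x ∈ U, derivAlong a (derivAlong a u) x = 0) ↔
      ∀ (I : Set ℝ) (γ : ℝ → EuclideanSpace ℝ (Fin n)),
        IsFlowCurve U a I γ → MapsToLineAtConstantSpeed u I γ := by
  constructor
  · intro heq I γ hγ
    obtain ⟨p, q, hpq⟩ := hγ.1.exists_eq_line hU hu hua heq
    refine ⟨p, q, fun hn => ?_, fun t ht => (hpq t ht).2⟩
    obtain ⟨t, ht⟩ := hγ.1.nonempty
    rw [← (hpq t ht).1]
    exact (ha.isTopDirection (hγ.1.mem t ht)).apply_ne_zero (by simpa using hn)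
  -- uniqueness of derivatives along a flow curve through `x`, first for `u ∘ γ`, then for `u_a ∘ γ`
  · intro hlines x hx
    obtain ⟨I, γ, hγ, t, ht, rfl⟩ := exists_isFlowCurve_of_mem hU ha_smooth hx
    obtain ⟨p, q, -, hpq⟩ := hlines I γ hγ
    have hq : ∀ s ∈ I, derivAlong a u (γ s) = q := fun s hs => by
      have h1 : HasDerivAt (fun r : ℝ => p + r • q) ((1 : ℝ) • q) s :=
        ((hasDerivAt_id s).smul_const q).const_add p
      rw [one_smul] at h1
      refine (hγ.1.hasDerivAt_comp hU hu hs).unique (h1.congr_of_eventuallyEq ?_)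
      filter_upwards [hγ.1.isOpen.mem_nhds hs] with r hr using hpq r hr
    refine (hγ.1.hasDerivAt_comp hU hua ht).unique
      ((hasDerivAt_const t q).congr_of_eventuallyEq ?_)
    filter_upwards [hγ.1.isOpen.mem_nhds ht] with r hr using hq r hr

end Lines

section Tight

open Filter Topology

variable {n m : ℕ} {U : Set (EuclideanSpace ℝ (Fin n))}
  {u v : EuclideanSpace ℝ (Fin n) → EuclideanSpace ℝ (Fin m)}
  {a : EuclideanSpace ℝ (Fin n) → EuclideanSpace ℝ (Fin n)}
  {I : Set ℝ} {γ : ℝ → EuclideanSpace ℝ (Fin n)}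

/-- The local Lipschitz constant controls increments along `1`-Lipschitz curves. -/
lemma norm_sub_le_of_localLip_le (hv : ContinuousOn v U) {s t : ℝ} (hst : s ≤ t)
    (hγ : LipschitzOnWith 1 γ (Set.Icc s t)) (hγU : ∀ r ∈ Set.Icc s t, γ r ∈ U) {L : ℝ≥0}
    (hL : ∀ r ∈ Set.Icc s t, localLip U v (γ r) ≤ L) :
    ‖v (γ t) - v (γ s)‖ ≤ L * (t - s) := by
  have hcont : ContinuousOn (fun r => ‖v (γ r) - v (γ s)‖) (Set.Icc s t) :=
    ((hv.comp hγ.continuousOn hγU).sub continuousOn_const).norm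
  refine image_le_of_liminf_slope_right_le_deriv_boundary (B := fun r => L * (r - s))
    (B' := fun _ => L) hcont (by simp) (by fun_prop) (fun x _ => ?_) (fun x hx r hr => ?_)
    (Set.right_mem_Icc.2 hst)
  · simpa using (((hasDerivAt_id x).sub_const s).const_mul (L : ℝ)).hasDerivWithinAt
  · obtain ⟨K, hLK, hKr⟩ := exists_between hr
    have hK0 : 0 ≤ K := L.2.trans hLK.le
    lift K to ℝ≥0 using hK0
    have hxI := Set.Ico_subset_Icc_self hx
    obtain ⟨ρ, hρ, hlip⟩ := exists_lipschitzOnWith_of_localLip_lt (K := K)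
      ((hL x hxI).trans_lt (by exact_mod_cast hLK))
    refine Eventually.frequently ?_
    have hIcc : Set.Icc s t ∈ 𝓝[>] x :=
      mem_of_superset (Ioo_mem_nhdsGT hx.2) fun z hz => ⟨hx.1.trans hz.1.le, hz.2.le⟩
    have hball : Set.Ioo x (x + ρ) ∈ 𝓝[>] x := Ioo_mem_nhdsGT (by linarith)
    filter_upwards [hIcc, hball] with z hz hzρ
    have hzx : 0 < z - x := by linarith [hzρ.1]
    have h1 : dist (γ z) (γ x) ≤ z - x := by
      have := hγ.dist_le_mul z hz x hxI
      rwa [NNReal.coe_one, one_mul, Real.dist_eq, abs_of_pos hzx] at this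
    have h2 := hlip.dist_le_mul (γ z) ⟨hγU z hz, by
      rw [Metric.mem_ball]; linarith [hzρ.2]⟩ (γ x) ⟨hγU x hxI, Metric.mem_ball_self hρ⟩
    have h3 : ‖v (γ z) - v (γ s)‖ - ‖v (γ x) - v (γ s)‖ ≤ K * (z - x) := by
      have h4 := norm_sub_norm_le (v (γ z) - v (γ s)) (v (γ x) - v (γ s))
      rw [sub_sub_sub_cancel_right, ← dist_eq_norm (v (γ z))] at h4
      exact h4.trans (h2.trans (by gcongr))
    rw [slope_def_field]
    refine lt_of_le_of_lt ?_ hKr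
    rwa [div_le_iff₀ hzx]

/-- If `v = u` on the boundary, then on a flow curve, which joins two boundary points and is mapped by
`u` to a segment at speed `|q|`, `v` covers at least the distance that `u` does. A tighter `v` would
cover less. -/
lemma isTight_of_lines (hU_bdd : Bornology.IsBounded U) (hU : IsOpen U)
    (hu_lip : IsLipschitzOnClosure U u) (hu : ContDiffOn ℝ 1 u U)
    (hua : DifferentiableOn ℝ (derivAlong a u) U)
    (ha : IsPrincipalDirectionField U u a) (ha_smooth : ContDiffOn ℝ 1 a U)
    (heq : ∀ x ∈ U, derivAlong a (derivAlong a u) x = 0) : IsTight U u := by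
  refine ⟨hu_lip, ?_⟩
  rintro ⟨v, -, ⟨Kv, hv⟩, hbdry, hgt⟩
  obtain ⟨Ku, hu'⟩ := hu_lip
  obtain ⟨x, hgtx⟩ := lt_iSup_iff.1 hgt
  obtain ⟨⟨hx, hvx⟩, hxR⟩ := lt_iSup_iff.1 hgtx
  obtain ⟨I, γ, hγ, t₀, ht₀, rfl⟩ := exists_isFlowCurve_of_mem hU ha_smooth hx
  have hud := hu.differentiableOn one_ne_zero
  obtain ⟨p, q, hpq⟩ := hγ.1.exists_eq_line hU hud hua heq
  have hLu : ∀ t ∈ I, localLip U u (γ t) = ‖q‖₊ := fun t ht => by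
    have hmem := hγ.1.mem t ht
    rw [localLip_eq_enorm_fderiv hU hmem (hu.contDiffAt (hU.mem_nhds hmem)), enorm_eq_nnnorm,
      ENNReal.coe_inj, ← NNReal.coe_inj, coe_nnnorm, coe_nnnorm, ← (hpq t ht).1]
    exact (ha.isTopDirection hmem).opNorm_eq
  have hLv : ∀ t ∈ I, localLip U v (γ t) ≤ ‖q‖₊ := fun t ht => by
    by_contra! hlt
    rw [← hLu t₀ ht₀] at hlt
    refine (hlt.trans (lt_of_le_of_lt ?_ hxR)).false
    refine le_iSup₂_of_le (γ t) ⟨hγ.1.mem t ht, ?_⟩ le_rfl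
    rwa [hLu t ht, ← hLu t₀ ht₀]
  have hq0 : 0 < ‖q‖ := by
    have := pos_of_gt hxR
    rw [hLu t₀ ht₀] at this
    exact_mod_cast this
  -- the flow curve has finite length because `u` is bounded
  have hIb : Bornology.IsBounded I := by
    have hcpt : IsCompact (closure U) := hU_bdd.isCompact_closure
    obtain ⟨D, hD⟩ := hcpt.exists_bound_of_continuousOn hu'.continuousOn
    refine isBounded_iff_forall_norm_le.2 ⟨(D + ‖p‖) / ‖q‖, fun t ht => ?_⟩
    rw [le_div_iff₀ hq0, ← norm_smul]
    have h1 : t • q = u (γ t) - p := by rw [(hpq t ht).2]; abel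
    rw [h1]
    exact (norm_sub_le _ _).trans (by gcongr; exact hD _ (subset_closure (hγ.1.mem t ht)))
  obtain ⟨α, β, hαβ, rfl⟩ := hγ.1.isOpen.exists_eq_Ioo_of_isBounded hγ.1.ordConnected
    hγ.1.nonempty hIb
  have hγlip := hγ.1.lipschitzOnWith ha.norm_eq_one
  obtain ⟨g, hg, hgγ⟩ := hγlip.extend_finite_dimension
  have hγα : Tendsto γ (𝓝[>] α) (𝓝 (g α)) := by
    refine ((hg.continuous.tendsto α).mono_left nhdsWithin_le_nhds).congr' ?_
    filter_upwards [Ioo_mem_nhdsGT hαβ] with t ht using (hgγ ht).symm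
  have hγβ : Tendsto γ (𝓝[<] β) (𝓝 (g β)) := by
    refine ((hg.continuous.tendsto β).mono_left nhdsWithin_le_nhds).congr' ?_
    filter_upwards [Ioo_mem_nhdsLT hαβ] with t ht using (hgγ ht).symm
  have hγcl : ∀ t ∈ Set.Ioo α β, γ t ∈ closure U := fun t ht => subset_closure (hγ.1.mem t ht)
  have hcα : g α ∈ closure U := isClosed_closure.mem_of_tendsto hγα
    (by filter_upwards [Ioo_mem_nhdsGT hαβ] with t ht using hγcl t ht)
  have hcβ : g β ∈ closure U := isClosed_closure.mem_of_tendsto hγβ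
    (by filter_upwards [Ioo_mem_nhdsLT hαβ] with t ht using hγcl t ht)
  have hfα : g α ∈ frontier U :=
    hU.frontier_eq ▸ ⟨hcα, hγ.notMem_of_tendsto_left hU ha_smooth hαβ hγα⟩
  have hfβ : g β ∈ frontier U :=
    hU.frontier_eq ▸ ⟨hcβ, hγ.notMem_of_tendsto_right hU ha_smooth hαβ hγβ⟩
  have hlim : ∀ f : EuclideanSpace ℝ (Fin n) → EuclideanSpace ℝ (Fin m),
      ContinuousOn f (closure U) → Tendsto (fun r : ℝ × ℝ => ‖f (γ r.2) - f (γ r.1)‖)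
        (𝓝[>] α ×ˢ 𝓝[<] β) (𝓝 ‖f (g β) - f (g α)‖) := by
    intro f hf
    have h1 : Tendsto (fun t => f (γ t)) (𝓝[>] α) (𝓝 (f (g α))) :=
      (hf _ hcα).tendsto.comp (tendsto_nhdsWithin_iff.2 ⟨hγα,
        by filter_upwards [Ioo_mem_nhdsGT hαβ] with t ht using hγcl t ht⟩)
    have h2 : Tendsto (fun t => f (γ t)) (𝓝[<] β) (𝓝 (f (g β))) :=
      (hf _ hcβ).tendsto.comp (tendsto_nhdsWithin_iff.2 ⟨hγβ,
        by filter_upwards [Ioo_mem_nhdsLT hαβ] with t ht using hγcl t ht⟩)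
    exact ((h2.comp tendsto_snd).sub (h1.comp tendsto_fst)).norm
  -- on a short piece of the curve after `t₀`, `v` gains less than `u`
  rw [hLu t₀ ht₀] at hvx
  obtain ⟨L, hvL, hLq⟩ := ENNReal.lt_iff_exists_nnreal_btwn.1 hvx
  have hLq' : (L : ℝ) < ‖q‖ := by exact_mod_cast hLq
  obtain ⟨ρ, hρ, hlip⟩ := exists_lipschitzOnWith_of_localLip_lt hvL
  obtain ⟨t₁, h01, h1β⟩ := exists_between (lt_min ht₀.2 (by linarith : t₀ < t₀ + ρ))
  have ht₁ : t₁ ∈ Set.Ioo α β := ⟨ht₀.1.trans h01, h1β.trans_le (min_le_left _ _)⟩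
  have hgain : ‖v (γ t₁) - v (γ t₀)‖ ≤ L * (t₁ - t₀) := by
    have h1 : dist (γ t₁) (γ t₀) ≤ t₁ - t₀ := by
      have := hγlip.dist_le_mul t₁ ht₁ t₀ ht₀
      rwa [NNReal.coe_one, one_mul, Real.dist_eq, abs_of_pos (by linarith)] at this
    have h2 := hlip.dist_le_mul (γ t₁) ⟨hγ.1.mem t₁ ht₁, by
      rw [Metric.mem_ball]; linarith [h1β.trans_le (min_le_right _ _)]⟩
      (γ t₀) ⟨hx, Metric.mem_ball_self hρ⟩
    rw [← dist_eq_norm]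
    exact h2.trans (by gcongr)
  have hvU : ContinuousOn v U := hv.continuousOn.mono subset_closure
  have hpiece : ∀ s ∈ Set.Ioo α β, ∀ t ∈ Set.Ioo α β, s ≤ t →
      ‖v (γ t) - v (γ s)‖ ≤ ‖q‖ * (t - s) := by
    intro s hs t ht hst
    have hsub : Set.Icc s t ⊆ Set.Ioo α β := Set.Icc_subset_Ioo hs.1 ht.2
    exact norm_sub_le_of_localLip_le hvU hst (hγlip.mono hsub)
      (fun r hr => hγ.1.mem r (hsub hr)) fun r hr => hLv r (hsub hr)
  have hle : ∀ᶠ r : ℝ × ℝ in 𝓝[>] α ×ˢ 𝓝[<] β,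
      ‖v (γ r.2) - v (γ r.1)‖ ≤ ‖u (γ r.2) - u (γ r.1)‖ - (‖q‖ - L) * (t₁ - t₀) := by
    filter_upwards [prod_mem_prod (Ioo_mem_nhdsGT ht₀.1) (Ioo_mem_nhdsLT ht₁.2)] with r hr
    obtain ⟨s, t⟩ := r
    have hs : s ∈ Set.Ioo α β := ⟨hr.1.1, hr.1.2.trans ht₀.2⟩
    have ht : t ∈ Set.Ioo α β := ⟨ht₁.1.trans hr.2.1, hr.2.2⟩
    have hst : 0 < t - s := by linarith [hr.1.2, hr.2.1]
    have e1 : ‖u (γ t) - u (γ s)‖ = ‖q‖ * (t - s) := by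
      rw [(hpq t ht).2, (hpq s hs).2, add_sub_add_left_eq_sub, ← sub_smul, norm_smul,
        Real.norm_eq_abs, abs_of_pos hst, mul_comm]
    have e2 := hpiece s hs t₀ ht₀ hr.1.2.le
    have e3 := hpiece t₁ ht₁ t ht hr.2.1.le
    have e4 : ‖v (γ t) - v (γ s)‖ ≤ ‖v (γ t) - v (γ t₁)‖ + ‖v (γ t₁) - v (γ t₀)‖ +
        ‖v (γ t₀) - v (γ s)‖ := by
      have := norm_add₃_le (a := v (γ t) - v (γ t₁)) (b := v (γ t₁) - v (γ t₀))
        (c := v (γ t₀) - v (γ s))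
      simpa using this
    simp only [e1]
    linarith
  have hfin := le_of_tendsto_of_tendsto (hlim v hv.continuousOn)
    ((hlim u hu'.continuousOn).sub_const _) hle
  rw [hbdry hfα, hbdry hfβ] at hfin
  have : 0 < (‖q‖ - L) * (t₁ - t₀) := mul_pos (by linarith) (by linarith)
  linarith

end Tight

theorem theorem1p4 {n m : ℕ} (U : Set (EuclideanSpace ℝ (Fin n)))
    (hU_bdd : Bornology.IsBounded U) (hU_open : IsOpen U)
    (u : EuclideanSpace ℝ (Fin n) → EuclideanSpace ℝ (Fin m))
    (hu_lip : IsLipschitzOnClosure U u) (hu : ContDiffOn ℝ 3 u U)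
    (a : EuclideanSpace ℝ (Fin n) → EuclideanSpace ℝ (Fin n))
    (ha : IsPrincipalDirectionField U u a) (ha_smooth : ContDiffOn ℝ 2 a U) :
    (IsTight U u ↔ ∀ x ∈ U, -(derivAlong a (derivAlong a u) x) = 0) ∧
    ((∀ x ∈ U, -(derivAlong a (derivAlong a u) x) = 0) ↔
      ∀ (I : Set ℝ) (γ : ℝ → EuclideanSpace ℝ (Fin n)),
        IsFlowCurve U a I γ → MapsToLineAtConstantSpeed u I γ) := by
  simp only [neg_eq_zero]
  have hu1 : ContDiffOn ℝ 1 u U := hu.of_le (by norm_num)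
  have ha1 : ContDiffOn ℝ 1 a U := ha_smooth.of_le (by norm_num)
  have hua : DifferentiableOn ℝ (derivAlong a u) U :=
    (hu.derivAlong hU_open ha_smooth (by norm_num)).differentiableOn two_ne_zero
  refine ⟨⟨fun htight x hx => ?_,
    isTight_of_lines hU_bdd hU_open hu_lip hu1 hua ha ha1⟩,
    forall_derivAlong_eq_zero_iff hU_open (hu1.differentiableOn one_ne_zero) hua ha ha1⟩
  by_contra hne
  by_cases h : ∀ z ∈ U, inner ℝ (derivAlong a u z) (derivAlong a (derivAlong a u) z) = 0
  · exact htight.2 (exists_isTighter_of_inner_eq_zero hU_open hu_lip hu ha ha_smooth h hx hne)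
  · push Not at h
    obtain ⟨z, hz, hzne⟩ := h
    exact htight.2 (exists_isTighter_of_inner_ne_zero hU_open hu_lip hu ha ha_smooth hz hzne)
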